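/- **Setting.** Consider a Markov decision process with (possibly infinite, measurable) state space $\mathcal S$, finite action space $\mathcal A$, discount $\gamma\in(0,1]$, and rewards in $\mathcal C=\mathbb R^m$, where $(R_{t+1},S_{t+1})$ is drawn from a joint kernel given $(S_t,A_t)$, and $\sup_{s,a}\mathbb E(\|R_{t+1}\|_1\mid S_t=s,A_t=a)<\infty$. The state is augmented with a stock $C_t\in\mathcal C$ that evolves as $C_{t+1}=\gamma^{-1}(C_t+R_{t+1})$. Let $\Pi$ be the set of stationary policies $\mathcal S\times\mathcal C\to\Delta(\mathcal A)$, $\Pi_{\mathrm M}$ the set of Markov policies (sequences of elements of $\Pi$), and $\Pi_{\mathrm H}$ the set of history-based policies, which choose $A_t$ from the whole history $(S_0,C_0),A_0,R_1,(S_1,C_1),\dots,R_t,(S_t,C_t)$; policies are measurable. For $\pi\in\Pi_{\mathrm H}$ let $\eta^\pi(s,c)$ be the law of $G^\pi(s,c)=\sum_{t\ge0}\gamma^tR_{t+1}$ when $(S_0,C_0)=(s,c)$ and $\pi$ is followed. A state $s$ is terminal if, whenever $S_t=s$, $(S_{t+1},R_{t+1})=(s,0)$ with probability one for every action. The MDP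 has finite horizon if for some $n\ge1$ the state $S_n$ is terminal with probability one on every trajectory; the least such $n$ is the horizon. Let $\mathrm w(\nu,\nu')=\inf\mathbb E\|X-X'\|_1$ (over all couplings $X\sim\nu$, $X'\sim\nu'$) be the 1-Wasserstein distance, let $(\mathcal D,\mathrm w)$ be the set of probability distributions $\nu$ on $\mathcal C$ with $\mathrm w(\nu,\delta_0)<\infty$, let $\overline{\mathrm w}(\eta,\eta')=\sup_{s,c}\mathrm w(\eta(s,c),\eta'(s,c))$, and let $(\mathcal D^{\mathcal S\times\mathcal C},\overline{\mathrm w})$ be the set of (measurable) $\eta$ assigning to each $(s,c)$ a probability distribution on $\mathcal C$, with $\sup_{s,c}\mathrm w(\eta(s,c),\delta_0)<\infty$. For $\pi\in\Pi$, $(T_\pi\eta)(s,c)$ is the law of $R_{t+1}+\gamma G(S_{t+1},C_{t+1})$ when $(S_t,C_t)=(s,c)$, $A_t\sim\pi(s,c)$ and $G(s',c')\sim\eta(s',c')$, with $(T_\pi\eta)(s,c)=\delta_0$ if $s$ is terminal. For $K:(\mathcal D,\mathrm w)\to\mathbb R$ write $K(X)$ for $K$ of the law of $X$, and $(F_K\eta)(s,c)=K(c+G(s,c))$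 with $G(s,c)\sim\eta(s,c)$. Suprema and inequalities between functions on $\mathcal S\times\mathcal C$ are pointwise. $K$ is *indifferent to mixtures* if for all $\eta,\eta'\in(\mathcal D^{\mathcal S\times\mathcal C},\overline{\mathrm w})$ with $K\eta(s,c)\ge K\eta'(s,c)$ for all $(s,c)$, we have $K(G(S,C))\ge K(G'(S,C))$ for every random $(S,C)\in\mathcal S\times\mathcal C$, where $G(s,c)\sim\eta(s,c)$ and $G'(s,c)\sim\eta'(s,c)$. $K$ is *indifferent to $\gamma$* if, for all $\nu,\nu'\in(\mathcal D,\mathrm w)$, $K\nu\ge K\nu'$ implies $K(\gamma G)\ge K(\gamma G')$, where $G\sim\nu$, $G'\sim\nu'$. $K$ is *$L$-Lipschitz* if $|K\nu-K\nu'|\le L\,\mathrm w(\nu,\nu')$ on $(\mathcal D,\mathrm w)$. **Theorem (Distributional Policy Iteration).** Let $K:(\mathcal D,\mathrm w)\to\mathbb R$ be indifferent to mixtures and indifferent to $\gamma$. Let $\pi_0\in\Pi$ be any stationary policy and let $\pi_1,\pi_2,\ldots\in\Pi$ satisfy, for all $n\ge0$, $$F_KT_{\pi_{n+1}}\eta^{\pi_n}=\sup_{\pi\in\Pi}F_KT_\pi\eta^{\pi_n}.$$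 *Finite-horizon case.* If the MDP has finite horizon, then for all $n$ greater than or equal to the horizon, $$F_K\eta^{\pi_n}=\sup_{\pi\in\Pi_{\mathrm H}}F_K\eta^\pi .$$ *Discounted case.* If $\gamma<1$ and $K$ is $L$-Lipschitz, then for all $n\ge0$, $$\sup_{\pi\in\Pi_{\mathrm H}}F_K\eta^\pi-F_K\eta^{\pi_n}\le L\gamma^n\cdot\sup_{\pi\in\Pi_{\mathrm M}}\overline{\mathrm w}(\eta^{\pi_0},\eta^\pi).$$ -/

import Mathlib

open MeasureTheory ProbabilityTheory
open scoped ENNReal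

universe u

namespace StockDP

/-! ### Distributions on `ℝᵐ` and the 1-Wasserstein distance -/

/-- The space `𝒞 = ℝᵐ` of rewards, returns and stocks. -/
abbrev Stock (m : ℕ) : Type := Fin m → ℝ

/-- The `ℓ¹` distance `‖x - y‖₁`, as an extended nonnegative real. -/
noncomputable def l1dist {m : ℕ} (x y : Stock m) : ℝ≥0∞ := ∑ i, ‖x i - y i‖ₑ

/-- `q` is the joint law of a pair with marginal laws `μ` and `ν`. -/
def IsCoupling {m : ℕ} (q : Measure (Stock m × Stock m)) (μ ν : Measure (Stock m)) : Prop :=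
  q.map Prod.fst = μ ∧ q.map Prod.snd = ν

/-- The 1-Wasserstein distance: the infimum of `𝔼 ‖X - X'‖₁` over all couplings. -/
noncomputable def wass {m : ℕ} (μ ν : Measure (Stock m)) : ℝ≥0∞ :=
  ⨅ (q : Measure (Stock m × Stock m)) (_ : IsCoupling q μ ν), ∫⁻ p, l1dist p.1 p.2 ∂q

/-- Membership in `(𝒟, w)`: a probability distribution with `w(μ, δ₀) < ∞`. -/
def InD {m : ℕ} (μ : Measure (Stock m)) : Prop :=
  IsProbabilityMeasure μ ∧ wass μ (Measure.dirac 0) < ∞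

/-- Augmented states `(s, c)`. -/
abbrev Aug (S : Type u) (m : ℕ) : Type u := S × Stock m

/-- The supremum 1-Wasserstein distance between return distribution functions. -/
noncomputable def supWass {S : Type u} {m : ℕ} (η η' : Aug S m → Measure (Stock m)) : ℝ≥0∞ :=
  ⨆ x, wass (η x) (η' x)

/-! ### Statistical functionals

A functional `K : (𝒟, w) → ℝ` is represented by a function on all measures; only its values on
`(𝒟, w)` are ever constrained, and its other values are irrelevant. -/

/-- Indifference to mixtures of initial augmented states: if `K η(s,c) ≥ K η'(s,c)` for all `(s,c)`,
then `K` also prefers the law of `G(X)` to that of `G'(X)`, for `X = (S, C)` with any law `ρ`. -/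
def IndifferentToMixtures (S : Type u) [MeasurableSpace S] {m : ℕ}
    (K : Measure (Stock m) → ℝ) : Prop :=
  ∀ η η' : Kernel (Aug S m) (Stock m), IsMarkovKernel η → IsMarkovKernel η' →
    supWass η (fun _ => Measure.dirac 0) < ∞ → supWass η' (fun _ => Measure.dirac 0) < ∞ →
    (∀ x, K (η' x) ≤ K (η x)) →
    ∀ ρ : Measure (Aug S m), IsProbabilityMeasure ρ → K (ρ.bind η') ≤ K (ρ.bind η)

/-- Indifference to `γ`: `K ν ≥ K ν'` implies `K (law of γ G) ≥ K (law of γ G')`. -/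
def IndifferentToDiscount {m : ℕ} (K : Measure (Stock m) → ℝ) (γ : ℝ) : Prop :=
  ∀ ν ν' : Measure (Stock m), InD ν → InD ν' → K ν' ≤ K ν →
    K (ν'.map fun g => γ • g) ≤ K (ν.map fun g => γ • g)

/-- `K` is `L`-Lipschitz on `(𝒟, w)`. -/
def LipschitzOnD {m : ℕ} (K : Measure (Stock m) → ℝ) (L : ℝ) : Prop :=
  ∀ ν ν' : Measure (Stock m), InD ν → InD ν' → |K ν - K ν'| ≤ L * (wass ν ν').toReal

/-- The stock-augmented objective `(F_K η)(s, c) = K (law of c + G(s, c))`. -/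
noncomputable def objective {S : Type u} {m : ℕ} (K : Measure (Stock m) → ℝ)
    (η : Aug S m → Measure (Stock m)) (x : Aug S m) : ℝ :=
  K ((η x).map fun g => x.2 + g)

/-! ### Markov decision processes and policies -/

/-- A Markov decision process with `ℝᵐ`-valued rewards: `dyn (s, a)` is the joint law of
`(R_{t+1}, S_{t+1})` given `S_t = s`, `A_t = a`, and `γ ∈ (0, 1]` is the discount. -/
structure MDP (S A : Type u) [MeasurableSpace S] [MeasurableSpace A] (m : ℕ) where
  dyn : Kernel (S × A) (Stock m × S)
  dyn_markov : IsMarkovKernel dyn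
  γ : ℝ
  γ_pos : 0 < γ
  γ_le_one : γ ≤ 1

/-- Everything observed at a time step: `(S₀, C₀)` at time `0`, and
`(A_n, R_{n+1}, (S_{n+1}, C_{n+1}))` at time `n + 1`. -/
def Obs (S A : Type u) (m : ℕ) : ℕ → Type u
  | 0 => Aug S m
  | _ + 1 => A × Stock m × Aug S m

instance Obs.measurableSpace (S A : Type u) [MeasurableSpace S] [MeasurableSpace A] (m : ℕ) :
    ∀ n, MeasurableSpace (Obs S A m n)
  | 0 => inferInstanceAs (MeasurableSpace (Aug S m))
  | _ + 1 => inferInstanceAs (MeasurableSpace (A × Stock m × Aug S m))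

/-- The augmented state contained in an observation. -/
def Obs.state {S A : Type u} {m : ℕ} : ∀ n, Obs S A m n → Aug S m
  | 0, o => o
  | _ + 1, o => o.2.2

/-- The reward contained in an observation made after time `0`. -/
def Obs.reward {S A : Type u} {m : ℕ} (n : ℕ) (o : Obs S A m (n + 1)) : Stock m := o.2.1

/-- Histories `H_t = (S₀, C₀), A₀, R₁, (S₁, C₁), …, R_t, (S_t, C_t)`. -/
abbrev Hist (S A : Type u) (m : ℕ) (t : ℕ) : Type u := (i : Finset.Iic t) → Obs S A m i

/-- Infinite trajectories. -/
abbrev Traj (S A : Type u) (m : ℕ) : Type u := (n : ℕ) → Obs S A m n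

/-- The last augmented state `(S_t, C_t)` of a history. -/
def Hist.last {S A : Type u} {m : ℕ} (t : ℕ) (h : Hist S A m t) : Aug S m :=
  Obs.state t (h ⟨t, Finset.mem_Iic.2 le_rfl⟩)

section Measurability

variable {S A : Type u} [MeasurableSpace S] [MeasurableSpace A] {m : ℕ}

theorem Obs.measurable_state (n : ℕ) : Measurable (Obs.state (S := S) (A := A) (m := m) n) := by
  cases n with
  | zero => exact measurable_id (α := Aug S m)
  | succ n => exact (measurable_snd.comp measurable_snd : Measurable
      fun o : A × Stock m × Aug S m => o.2.2)

theorem Obs.measurable_reward (n : ℕ) : Measurable (Obs.reward (S := S) (A := A) (m := m) n) :=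
  (measurable_fst.comp measurable_snd : Measurable fun o : A × Stock m × Aug S m => o.2.1)

theorem Hist.measurable_last (t : ℕ) : Measurable (Hist.last (S := S) (A := A) (m := m) t) :=
  (Obs.measurable_state t).comp (measurable_pi_apply _)

end Measurability

/-- A history-based policy: a (measurable) choice of a distribution over actions for every finite
history. -/
structure HistoryPolicy (S A : Type u) [MeasurableSpace S] [MeasurableSpace A] (m : ℕ) where
  act : ∀ t, Kernel (Hist S A m t) A
  act_markov : ∀ t, IsMarkovKernel (act t)

/-- A stationary policy: a (measurable) map from augmented states to distributions over actions. -/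
structure StationaryPolicy (S A : Type u) [MeasurableSpace S] [MeasurableSpace A] (m : ℕ) where
  act : Kernel (Aug S m) A
  act_markov : IsMarkovKernel act

/-- A Markov policy: a sequence of stationary policies, used one after the other. -/
abbrev MarkovPolicy (S A : Type u) [MeasurableSpace S] [MeasurableSpace A] (m : ℕ) : Type u :=
  ℕ → StationaryPolicy S A m

attribute [instance] MDP.dyn_markov HistoryPolicy.act_markov StationaryPolicy.act_markov

section Dynamics

variable {S A : Type u} [MeasurableSpace S] [MeasurableSpace A] {m : ℕ}

/-- A Markov policy, seen as a history-based policy. -/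
noncomputable def MarkovPolicy.toHistory (π : MarkovPolicy S A m) : HistoryPolicy S A m where
  act t := (π t).act.comap (Hist.last t) (Hist.measurable_last t)
  act_markov _ := inferInstance

/-- A stationary policy, seen as a history-based policy. -/
noncomputable def StationaryPolicy.toHistory (π : StationaryPolicy S A m) : HistoryPolicy S A m :=
  MarkovPolicy.toHistory fun _ => π

namespace MDP

variable (M : MDP S A m)

/-- All rewards have uniformly bounded first moment: `sup_{s,a} 𝔼(‖R_{t+1}‖₁ | s, a) < ∞`. -/
def BoundedRewards : Prop :=
  (⨆ p : S × A, ∫⁻ y, l1dist y.1 0 ∂(M.dyn p)) < ∞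

/-- A state `s` is terminal if `(S_{t+1}, R_{t+1})` has law `δ_(s, 0)` whenever `S_t = s`. -/
def IsTerminal (s : S) : Prop := ∀ a, M.dyn (s, a) = Measure.dirac (0, s)

/-- The dynamics with stock: given `((S_t, C_t), A_t)`, the joint law of
`(R_{t+1}, (S_{t+1}, C_{t+1}))` where `C_{t+1} = γ⁻¹ (C_t + R_{t+1})`. -/
noncomputable def augDyn : Kernel (Aug S m × A) (Stock m × Aug S m) :=
  (Kernel.id ×ₖ M.dyn.comap (fun p : Aug S m × A => (p.1.1, p.2)) (by fun_prop)).map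
    fun q : (Aug S m × A) × (Stock m × S) => (q.2.1, (q.2.2, M.γ⁻¹ • (q.1.1.2 + q.2.1)))

instance : IsMarkovKernel M.augDyn :=
  Kernel.IsMarkovKernel.map _ (by fun_prop)

/-- Given a history `H_t`, the law of `(A_t, R_{t+1}, (S_{t+1}, C_{t+1}))` under `π`. -/
noncomputable def step (π : HistoryPolicy S A m) (t : ℕ) :
    Kernel (Hist S A m t) (Obs S A m (t + 1)) :=
  (π.act t ⊗ₖ M.augDyn.comap (fun p : Hist S A m t × A => (Hist.last t p.1, p.2))
    (((Hist.measurable_last t).comp measurable_fst).prodMk measurable_snd) :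
    Kernel (Hist S A m t) (A × Stock m × Aug S m))

instance (π : HistoryPolicy S A m) (t : ℕ) : IsMarkovKernel (M.step π t) :=
  inferInstanceAs (IsMarkovKernel
    (π.act t ⊗ₖ M.augDyn.comap (fun p : Hist S A m t × A => (Hist.last t p.1, p.2)) _))

/-- The history of length zero that starts at an augmented state. -/
def initHist (x : Aug S m) : Hist S A m 0 :=
  fun i => match i with
    | ⟨0, _⟩ => x
    | ⟨k + 1, hk⟩ => absurd (Finset.mem_Iic.1 hk) (Nat.not_succ_le_zero k)

theorem measurable_initHist : Measurable (initHist (S := S) (A := A) (m := m)) := by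
  refine measurable_pi_lambda _ fun i => ?_
  match i with
  | ⟨0, _⟩ => exact measurable_id (α := Aug S m)
  | ⟨k + 1, hk⟩ => exact absurd (Finset.mem_Iic.1 hk) (Nat.not_succ_le_zero k)

/-- The law of the trajectory generated by `π` from the initial augmented state. -/
noncomputable def traj (π : HistoryPolicy S A m) : Kernel (Aug S m) (Traj S A m) :=
  (Kernel.traj (M.step π) 0).comap initHist measurable_initHist

instance (π : HistoryPolicy S A m) : IsMarkovKernel (M.traj π) :=
  inferInstanceAs (IsMarkovKernel ((Kernel.traj (M.step π) 0).comap initHist _))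

/-- The discounted return `∑ₜ γᵗ R_{t+1}` of a trajectory. -/
noncomputable def ret (ω : Traj S A m) : Stock m :=
  ∑' t : ℕ, M.γ ^ t • Obs.reward t (ω (t + 1))

theorem measurable_ret : Measurable M.ret :=
  Measurable.tsum fun t =>
    ((Obs.measurable_reward t).comp (measurable_pi_apply (t + 1))).const_smul (M.γ ^ t)

/-- The return distribution function `η^π`. -/
noncomputable def retDist (π : HistoryPolicy S A m) : Kernel (Aug S m) (Stock m) :=
  (M.traj π).map M.ret

instance (π : HistoryPolicy S A m) : IsMarkovKernel (M.retDist π) :=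
  Kernel.IsMarkovKernel.map _ M.measurable_ret

open Classical in
/-- The stock-augmented distributional Bellman operator: `(T_π η)(s, c)` is the law of
`R_{t+1} + γ G(S_{t+1}, C_{t+1})` where `(S_t, C_t) = (s, c)`, `A_t ∼ π(s, c)` and, given
`(R_{t+1}, S_{t+1}, C_{t+1})`, `G(S_{t+1}, C_{t+1}) ∼ η(S_{t+1}, C_{t+1})`; it is `δ₀` if `s` is
terminal. -/
noncomputable def bellman (π : StationaryPolicy S A m) (η : Kernel (Aug S m) (Stock m))
    (x : Aug S m) : Measure (Stock m) :=
  if M.IsTerminal x.1 then Measure.dirac 0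
  else (((π.act x).bind fun a => M.augDyn (x, a)) ⊗ₘ Kernel.prodMkLeft (Stock m) η).map
    fun q : (Stock m × Aug S m) × Stock m => q.1.1 + M.γ • q.2

/-- `S_n` is terminal with probability one along every trajectory. -/
def TerminatesBy (n : ℕ) : Prop :=
  ∀ (π : HistoryPolicy S A m) (x : Aug S m),
    ∀ᵐ ω ∂(M.traj π x), M.IsTerminal (Obs.state n (ω n)).1

/-- The MDP has finite horizon, and its horizon is `N`: the least `n ≥ 1` such that `S_n` is
terminal with probability one along every trajectory. -/
def HasHorizon (N : ℕ) : Prop := IsLeast {n | 1 ≤ n ∧ M.TerminatesBy n} N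

/-- `π'` is greedy with respect to `η`: `F_K T_π' η = sup_π F_K T_π η`, the supremum being
pointwise over the stationary policies. -/
def IsGreedy (K : Measure (Stock m) → ℝ) (η : Kernel (Aug S m) (Stock m))
    (π' : StationaryPolicy S A m) : Prop :=
  ∀ x, (objective K (M.bellman π' η) x : EReal) =
    ⨆ π : StationaryPolicy S A m, (objective K (M.bellman π η) x : EReal)

end MDP

end Dynamics

end StockDP

/-!
A history-based policy enters the objective only through the law of `c + G`. As the stock records
past rewards, `γᵗ C_t = c + ∑_{k < t} γᵏ R_{k+1}`, the law of `c + G` is the limit in law of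
`γᵗ C_t` and is determined by the laws of the augmented states
(`ReturnsBoundedBy.tendsto_integral_stock`). From a fixed initial augmented state, a Markov policy
that draws `A_t` from its conditional law given `(S_t, C_t)` reproduces these laws
(`exists_markov_stateLaw_eq`), so it suffices to compete with Markov policies.

The same limit gives the dynamic programming identity `ReturnsBoundedBy.translate_retDist_eq_bind`:
the law of `c + G` under a Markov policy is that of `γⁿ (C_n + G')`, with `G'` the return of the
shifted policy started at `(S_n, C_n)`. In particular the Bellman operator `T_π` applied to the
returns of a policy `σ` gives the objective of following `π` for one step and then `σ`. Indifference
to mixtures and to `γ` makes this operation monotone in the objective of `σ`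
(`ReturnsBoundedBy.value_cons_mono`). Hence each greedy step improves the policy, and by induction
`π_n` is at least as good as every Markov policy followed for `n` steps before switching to `π₀`
(`ReturnsBoundedBy.value_splice_le`). After the horizon the switch is invisible; in the discounted
case it costs at most `L γⁿ` times the distance to `π₀`, by the dynamic programming identity and the
convexity of the Wasserstein distance under mixtures.

Three points need more than this outline.

* Indifference to mixtures is assumed for uniformly bounded families of distributions, whereas the
  translated returns `c + G(s, c)` are unbounded in `c`. `IndifferentToMixtures.bind_le` extends it
  to mixtures with integrable first moment. Diluting the component at `x` with weight `1 / w x`,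
  where `w` dominates the moments, and reweighting the mixing law by `w / N` produces a bounded
  family whose mixture is the original one diluted with weight `1 / N`. The third distribution in
  the dilution is arbitrary, so that one mixture can be turned into the other in `N` such steps.
* Convexity of the Wasserstein distance requires a measurable choice of couplings. Kernels are
  represented by functions of a uniform variable, and separability of `L¹` reduces the choice to
  countably many couplings (`exists_countable_approx`). The approximation errors are absorbed by
  the Lipschitz functional itself (`LipschitzOnD.sub_bind_le`), without a triangle inequality for
  `wass`.
* The set of terminal states need not be measurable. The functions `worstReward k`, the worst
  expected reward `k` steps ahead, are measurable and vanish at terminal states; they replace it.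
-/

namespace StockDP

/-! ### Wasserstein distance and first moments -/

section Wasserstein

variable {m : ℕ}

@[fun_prop]
theorem measurable_l1dist : Measurable fun p : Stock m × Stock m => l1dist p.1 p.2 := by
  unfold l1dist
  fun_prop

@[fun_prop]
theorem _root_.Measurable.l1dist {Ω : Type*} [MeasurableSpace Ω] {f g : Ω → Stock m}
    (hf : Measurable f) (hg : Measurable g) : Measurable fun ω => l1dist (f ω) (g ω) :=
  measurable_l1dist.comp (hf.prodMk hg)

theorem l1dist_self (x : Stock m) : l1dist x x = 0 := by
  simp [l1dist]

theorem l1dist_comm (x y : Stock m) : l1dist x y = l1dist y x := by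
  simp only [l1dist]
  exact Finset.sum_congr rfl fun i _ => by rw [← enorm_neg, neg_sub]

theorem l1dist_zero_lt_top (x : Stock m) : l1dist x 0 < ∞ := by
  simp [l1dist, ENNReal.sum_lt_top]

theorem l1dist_triangle (x y z : Stock m) : l1dist x z ≤ l1dist x y + l1dist y z := by
  simp only [l1dist, ← Finset.sum_add_distrib]
  refine Finset.sum_le_sum fun i _ => ?_
  rw [show x i - z i = (x i - y i) + (y i - z i) by ring]
  exact enorm_add_le _ _

theorem l1dist_add_zero_le (x y : Stock m) : l1dist (x + y) 0 ≤ l1dist x 0 + l1dist y 0 := by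
  simp only [l1dist, ← Finset.sum_add_distrib, Pi.zero_apply, sub_zero, Pi.add_apply]
  exact Finset.sum_le_sum fun i _ => enorm_add_le _ _

theorem l1dist_smul (a : ℝ) (x y : Stock m) : l1dist (a • x) (a • y) = ‖a‖ₑ * l1dist x y := by
  simp only [l1dist, Finset.mul_sum, Pi.smul_apply, smul_eq_mul, ← mul_sub, enorm_mul]

theorem l1dist_smul_zero (a : ℝ) (x : Stock m) : l1dist (a • x) 0 = ‖a‖ₑ * l1dist x 0 := by
  rw [← l1dist_smul, smul_zero]

theorem l1dist_add_left (c x y : Stock m) : l1dist (c + x) (c + y) = l1dist x y := by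
  simp [l1dist]

theorem l1dist_le_enorm (x y : Stock m) : l1dist x y ≤ m * ‖x - y‖ₑ := by
  simp only [l1dist]
  calc ∑ i, ‖x i - y i‖ₑ ≤ ∑ _i : Fin m, ‖x - y‖ₑ :=
        Finset.sum_le_sum fun i _ => enorm_le_iff_norm_le.2 (norm_le_pi_norm (x - y) i)
    _ = m * ‖x - y‖ₑ := by simp

theorem enorm_le_l1dist (x : Stock m) : ‖x‖ₑ ≤ l1dist x 0 := by
  have h : ‖x‖ ≤ ∑ i, ‖x i‖ := (pi_norm_le_iff_of_nonneg (by positivity)).2 fun i =>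
    Finset.single_le_sum (f := fun i => ‖x i‖) (fun _ _ => norm_nonneg _) (Finset.mem_univ i)
  simp only [l1dist, Pi.zero_apply, sub_zero, ← ofReal_norm]
  rw [← ENNReal.ofReal_sum_of_nonneg fun _ _ => norm_nonneg _]
  exact ENNReal.ofReal_le_ofReal h

/-- The first absolute moment `𝔼 ‖X‖₁` of a distribution on `ℝᵐ`. -/
noncomputable def moment (μ : Measure (Stock m)) : ℝ≥0∞ := ∫⁻ g, l1dist g 0 ∂μ

theorem wass_map_map_le {Ω : Type*} [MeasurableSpace Ω] (μ : Measure Ω) {f g : Ω → Stock m}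
    (hf : Measurable f) (hg : Measurable g) :
    wass (μ.map f) (μ.map g) ≤ ∫⁻ ω, l1dist (f ω) (g ω) ∂μ := by
  refine iInf₂_le_of_le (μ.map fun ω => (f ω, g ω)) ⟨?_, ?_⟩ ?_
  · rw [Measure.map_map measurable_fst (hf.prodMk hg)]; rfl
  · rw [Measure.map_map measurable_snd (hf.prodMk hg)]; rfl
  · rw [lintegral_map measurable_l1dist (hf.prodMk hg)]

theorem wass_le_moment_add_moment (μ ν : Measure (Stock m)) [IsProbabilityMeasure μ]
    [IsProbabilityMeasure ν] : wass μ ν ≤ moment μ + moment ν := by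
  refine iInf₂_le_of_le (μ.prod ν) ⟨by simp, by simp⟩ ?_
  calc ∫⁻ p, l1dist p.1 p.2 ∂(μ.prod ν)
      ≤ ∫⁻ p, (l1dist p.1 0 + l1dist p.2 0) ∂(μ.prod ν) := by
        refine lintegral_mono fun p => (l1dist_triangle p.1 0 p.2).trans_eq ?_
        rw [l1dist_comm 0]
    _ = moment μ + moment ν := by
        rw [lintegral_add_left (by fun_prop), moment, moment]
        congr 1
        · rw [lintegral_prod _ (by fun_prop)]; simp
        · rw [lintegral_prod _ (by fun_prop)]; simp

theorem IsCoupling.moment_le {q : Measure (Stock m × Stock m)} {μ ν : Measure (Stock m)}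
    (hq : IsCoupling q μ ν) : moment μ ≤ ∫⁻ p, l1dist p.1 p.2 ∂q + moment ν := by
  rw [moment, moment, ← hq.1, ← hq.2, lintegral_map (by fun_prop) measurable_fst,
    lintegral_map (by fun_prop) measurable_snd, ← lintegral_add_left (by fun_prop)]
  exact lintegral_mono fun p => l1dist_triangle _ _ _

theorem moment_le_wass_add (μ ν : Measure (Stock m)) : moment μ ≤ wass μ ν + moment ν := by
  simp only [wass, ENNReal.iInf_add]
  exact le_iInf₂ fun q hq => hq.moment_le

theorem moment_dirac_zero : moment (Measure.dirac (0 : Stock m)) = 0 := by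
  rw [moment, lintegral_dirac' _ (by fun_prop), l1dist_self]

theorem wass_dirac_zero (μ : Measure (Stock m)) [IsProbabilityMeasure μ] :
    wass μ (Measure.dirac 0) = moment μ := by
  refine le_antisymm ?_ ?_
  · simpa [moment_dirac_zero] using wass_le_moment_add_moment μ (Measure.dirac 0)
  · simpa [moment_dirac_zero] using moment_le_wass_add μ (Measure.dirac 0)

theorem inD_iff {μ : Measure (Stock m)} : InD μ ↔ IsProbabilityMeasure μ ∧ moment μ < ∞ := by
  refine and_congr_right fun h => ?_
  rw [wass_dirac_zero]

theorem InD.of_moment_lt {μ : Measure (Stock m)} [h : IsProbabilityMeasure μ]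
    (hμ : moment μ < ∞) : InD μ := inD_iff.2 ⟨h, hμ⟩

theorem InD.moment_lt_top {μ : Measure (Stock m)} (h : InD μ) : moment μ < ∞ := (inD_iff.1 h).2

theorem InD.wass_lt_top {μ ν : Measure (Stock m)} (hμ : InD μ) (hν : InD ν) : wass μ ν < ∞ := by
  have := hμ.1
  have := hν.1
  exact (wass_le_moment_add_moment μ ν).trans_lt
    (ENNReal.add_lt_top.2 ⟨hμ.moment_lt_top, hν.moment_lt_top⟩)

theorem moment_map_smul (a : ℝ) (μ : Measure (Stock m)) :
    moment (μ.map fun g => a • g) = ‖a‖ₑ * moment μ := by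
  rw [moment, lintegral_map (by fun_prop) (by fun_prop), moment,
    ← lintegral_const_mul _ (by fun_prop)]
  simp_rw [l1dist_smul_zero]

theorem moment_map_add_le (c : Stock m) (μ : Measure (Stock m)) [IsProbabilityMeasure μ] :
    moment (μ.map fun g => c + g) ≤ l1dist c 0 + moment μ := by
  rw [moment, lintegral_map (by fun_prop) (by fun_prop), moment]
  calc _ ≤ ∫⁻ g, (l1dist c 0 + l1dist g 0) ∂μ := lintegral_mono fun g => l1dist_add_zero_le _ _
    _ = _ := by rw [lintegral_add_left (by fun_prop)]; simp

theorem wass_map_affine_le {a : ℝ} (ha : a ≠ 0) (c : Stock m) (μ ν : Measure (Stock m)) :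
    wass (μ.map fun g => a • (c + g)) (ν.map fun g => a • (c + g)) ≤ ‖a‖ₑ * wass μ ν := by
  simp only [wass, ENNReal.mul_iInf_of_ne (enorm_ne_zero.2 ha) enorm_ne_top]
  refine le_iInf₂ fun q hq => ?_
  have h := wass_map_map_le q (f := fun p => a • (c + p.1)) (g := fun p => a • (c + p.2))
    (by fun_prop) (by fun_prop)
  simp only [l1dist_smul, l1dist_add_left] at h
  rw [lintegral_const_mul _ (by fun_prop)] at h
  rw [← hq.1, ← hq.2, Measure.map_map (by fun_prop) (by fun_prop),
    Measure.map_map (by fun_prop) (by fun_prop)]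
  exact h

end Wasserstein

section Mixture

variable {m : ℕ} {Ω : Type*} [MeasurableSpace Ω]

theorem moment_bind (ρ : Measure Ω) (ζ : Kernel Ω (Stock m)) :
    moment (ρ.bind ζ) = ∫⁻ ω, moment (ζ ω) ∂ρ :=
  Measure.lintegral_bind ζ.aemeasurable (by fun_prop)

theorem measurable_moment (ζ : Kernel Ω (Stock m)) : Measurable fun ω => moment (ζ ω) :=
  Measurable.lintegral_kernel (by fun_prop)

/-- A measurable choice of couplings of `ζ ω` and `ζ' ω` gives a coupling of the mixtures. -/
theorem wass_bind_le_of_kernel (ρ : Measure Ω) (ζ ζ' : Kernel Ω (Stock m))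
    (q : Kernel Ω (Stock m × Stock m)) (hq : ∀ ω, IsCoupling (q ω) (ζ ω) (ζ' ω)) :
    wass (ρ.bind ζ) (ρ.bind ζ') ≤ ∫⁻ ω, ∫⁻ p, l1dist p.1 p.2 ∂(q ω) ∂ρ := by
  have h1 : ζ = q.map Prod.fst := by
    ext1 ω; rw [Kernel.map_apply _ measurable_fst, (hq ω).1]
  have h2 : ζ' = q.map Prod.snd := by
    ext1 ω; rw [Kernel.map_apply _ measurable_snd, (hq ω).2]
  refine iInf₂_le_of_le (ρ.bind q) ⟨?_, ?_⟩ ?_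
  · rw [Measure.map_comp _ _ measurable_fst, h1]
  · rw [Measure.map_comp _ _ measurable_snd, h2]
  · rw [Measure.lintegral_bind q.aemeasurable (by fun_prop)]

theorem exists_isCoupling_lintegral_le {μ ν : Measure (Stock m)} {W ε : ℝ≥0∞}
    (hW : wass μ ν ≤ W) (hW' : W ≠ ∞) (hε : ε ≠ 0) :
    ∃ q, IsCoupling q μ ν ∧ ∫⁻ p, l1dist p.1 p.2 ∂q ≤ W + ε := by
  have : wass μ ν < W + ε := hW.trans_lt (ENNReal.lt_add_right hW' hε)
  simp only [wass, iInf_lt_iff] at this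
  obtain ⟨q, hq, h⟩ := this
  exact ⟨q, hq, h.le⟩

/-- A jointly measurable function of `ω` and of a uniform variable defines a kernel. -/
theorem exists_kernel_eq_map {Y : Type*} [MeasurableSpace Y] {H : Ω → unitInterval → Y}
    (hH : Measurable (Function.uncurry H)) :
    ∃ q : Kernel Ω Y, ∀ ω, q ω = volume.map (H ω) := by
  refine ⟨(Kernel.id ×ₖ Kernel.const Ω volume).map (Function.uncurry H), fun ω => ?_⟩
  rw [Kernel.map_apply _ hH, Kernel.prod_apply, Kernel.id_apply, Kernel.const_apply,
    Measure.dirac_prod, Measure.map_map hH (by fun_prop)]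
  rfl

theorem memLp_one_of_lintegral_l1dist {X : Type*} [MeasurableSpace X] {μ : Measure X}
    {h : X → Stock m} (hh : Measurable h) (hi : ∫⁻ u, l1dist (h u) 0 ∂μ < ∞) : MemLp h 1 μ := by
  refine ⟨hh.aestronglyMeasurable, ?_⟩
  rw [eLpNorm_one_eq_lintegral_enorm]
  exact (lintegral_mono fun u => enorm_le_l1dist _).trans_lt hi

theorem lintegral_l1dist_le_of_edist_toLp_lt {X : Type*} [MeasurableSpace X] {μ : Measure X}
    {h : X → Stock m} (hh : MemLp h 1 μ) (k : Lp (Stock m) 1 μ) {ε : ℝ≥0∞}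
    (hk : edist (hh.toLp h) k < ε / (m + 1)) : ∫⁻ u, l1dist (h u) (k u) ∂μ ≤ ε := by
  rw [Lp.edist_def, eLpNorm_one_eq_lintegral_enorm] at hk
  calc ∫⁻ u, l1dist (h u) (k u) ∂μ
      ≤ ∫⁻ u, (m + 1 : ℝ≥0∞) * ‖(⇑(hh.toLp h) - ⇑k) u‖ₑ ∂μ := by
        refine lintegral_mono_ae ?_
        filter_upwards [hh.coeFn_toLp] with u hu
        rw [Pi.sub_apply, hu]
        exact (l1dist_le_enorm _ _).trans (mul_le_mul_left le_self_add _)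
    _ = (m + 1 : ℝ≥0∞) * ∫⁻ u, ‖(⇑(hh.toLp h) - ⇑k) u‖ₑ ∂μ := by
        rw [lintegral_const_mul' _ _ (by finiteness)]
    _ ≤ (m + 1 : ℝ≥0∞) * (ε / (m + 1)) := by gcongr
    _ = ε := ENNReal.mul_div_cancel (by simp) (by finiteness)

/-- Countably many integrable functions are `L¹`-dense. -/
theorem exists_seq_lintegral_l1dist_le (m : ℕ) : ∃ g : ℕ → unitInterval → Stock m,
    (∀ n, Measurable (g n)) ∧ ∀ h : unitInterval → Stock m, Measurable h →
      ∫⁻ u, l1dist (h u) 0 < ∞ → ∀ ε : ℝ≥0∞, ε ≠ 0 → ∃ n, ∫⁻ u, l1dist (h u) (g n u) ≤ ε := by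
  have : Fact ((1 : ℝ≥0∞) ≠ ∞) := ⟨ENNReal.one_ne_top⟩
  have : SecondCountableTopology (Lp (Stock m) 1 (volume : Measure unitInterval)) :=
    Lp.SecondCountableTopology
  let d := TopologicalSpace.denseSeq (Lp (Stock m) 1 (volume : Measure unitInterval))
  refine ⟨fun n => d n, fun n => (Lp.stronglyMeasurable _).measurable, fun h hh hi ε hε => ?_⟩
  have hL := memLp_one_of_lintegral_l1dist hh hi
  have hδ : ε / (m + 1) ≠ 0 := by simp [ENNReal.div_eq_zero_iff, hε]
  obtain ⟨_, ⟨n, rfl⟩, hn⟩ := EMetric.mem_closure_iff.1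
    (TopologicalSpace.denseRange_denseSeq _ (hL.toLp _)) _ (pos_iff_ne_zero.2 hδ)
  exact ⟨n, lintegral_l1dist_le_of_edist_toLp_lt hL _ hn⟩

/-- Two integrable random functions are simultaneously approximated, up to a measurable choice of
an index, by countably many fixed functions: this is the separability of `L¹`. -/
theorem exists_index_lintegral_le {f f' : Ω → unitInterval → Stock m}
    (hf : Measurable (Function.uncurry f)) (hf' : Measurable (Function.uncurry f'))
    (hfi : ∀ ω, ∫⁻ u, l1dist (f ω u) 0 < ∞) (hfi' : ∀ ω, ∫⁻ u, l1dist (f' ω u) 0 < ∞)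
    {ε : ℝ≥0∞} (hε : ε ≠ 0) :
    ∃ (g g' : ℕ → unitInterval → Stock m) (idx : Ω → ℕ), (∀ n, Measurable (g n)) ∧
      (∀ n, Measurable (g' n)) ∧ Measurable idx ∧
      (∀ ω, ∫⁻ u, l1dist (f ω u) (g (idx ω) u) ≤ ε) ∧
      ∀ ω, ∫⁻ u, l1dist (f' ω u) (g' (idx ω) u) ≤ ε := by
  obtain ⟨g, hg, hgd⟩ := exists_seq_lintegral_l1dist_le m
  have hmeas : ∀ {h : Ω → unitInterval → Stock m} {k : unitInterval → Stock m},
      Measurable (Function.uncurry h) → Measurable k →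
      MeasurableSet {ω | ∫⁻ u, l1dist (h ω u) (k u) ≤ ε} := fun {h k} hh hk => by
    have : Measurable fun p : Ω × unitInterval => l1dist (h p.1 p.2) (k p.2) :=
      Measurable.l1dist hh (hk.comp measurable_snd)
    exact measurableSet_le this.lintegral_prod_right' measurable_const
  -- A single index codes the approximants of both functions.
  have hex : ∀ ω, ∃ n : ℕ, ∫⁻ u, l1dist (f ω u) (g n.unpair.1 u) ≤ ε ∧
      ∫⁻ u, l1dist (f' ω u) (g n.unpair.2 u) ≤ ε := fun ω => by
    obtain ⟨i, hi⟩ := hgd _ hf.of_uncurry_left (hfi ω) ε hε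
    obtain ⟨j, hj⟩ := hgd _ hf'.of_uncurry_left (hfi' ω) ε hε
    exact ⟨Nat.pair i j, by simpa using hi, by simpa using hj⟩
  classical
  exact ⟨fun n => g n.unpair.1, fun n => g n.unpair.2, fun ω => Nat.find (hex ω),
    fun n => hg _, fun n => hg _,
    measurable_find hex fun n => (hmeas hf (hg _)).inter (hmeas hf' (hg _)),
    fun ω => (Nat.find_spec (hex ω)).1, fun ω => (Nat.find_spec (hex ω)).2⟩

/-- Two kernels with finite first moments are simultaneously `ε`-close, in a measurable way, to
kernels `ζ ∘ ψ` and `ζ' ∘ ψ` where `ψ` only takes countably many values. -/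
theorem exists_countable_approx [Nonempty Ω] (ζ ζ' : Kernel Ω (Stock m)) [IsMarkovKernel ζ]
    [IsMarkovKernel ζ'] (hζ : ∀ ω, moment (ζ ω) < ∞) (hζ' : ∀ ω, moment (ζ' ω) < ∞)
    {ε : ℝ≥0∞} (hε : ε ≠ 0) :
    ∃ (idx : Ω → ℕ) (rep : ℕ → Ω) (q q' : Kernel Ω (Stock m × Stock m)), Measurable idx ∧
      (∀ ω, IsCoupling (q ω) (ζ ω) (ζ (rep (idx ω))) ∧ ∫⁻ p, l1dist p.1 p.2 ∂(q ω) ≤ ε) ∧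
      ∀ ω, IsCoupling (q' ω) (ζ' (rep (idx ω))) (ζ' ω) ∧ ∫⁻ p, l1dist p.1 p.2 ∂(q' ω) ≤ ε := by
  obtain ⟨f, hf, hfζ⟩ := ζ.exists_measurable_map_eq_unitInterval
  obtain ⟨f', hf', hfζ'⟩ := ζ'.exists_measurable_map_eq_unitInterval
  have hm : ∀ ω, Measurable (f ω) := fun ω => hf.of_uncurry_left
  have hm' : ∀ ω, Measurable (f' ω) := fun ω => hf'.of_uncurry_left
  obtain ⟨g, g', idx, hg, hg', hidx, h1, h2⟩ := exists_index_lintegral_le hf hf'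
    (fun ω => by
      have := hζ ω
      rwa [moment, ← hfζ, lintegral_map (by fun_prop) (hm ω)] at this)
    (fun ω => by
      have := hζ' ω
      rwa [moment, ← hfζ', lintegral_map (by fun_prop) (hm' ω)] at this)
    (ENNReal.half_pos hε).ne'
  -- One representative for each value of the index: `ω` and `rep (idx ω)` have the same
  -- approximants, hence are close to each other.
  let rep := Function.invFun idx
  have hrep : ∀ ω, idx (rep (idx ω)) = idx ω := fun ω => Function.invFun_eq ⟨ω, rfl⟩
  have hψ : Measurable fun ω => rep (idx ω) := (measurable_from_nat (f := rep)).comp hidx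
  have hfψ : Measurable fun p : Ω × unitInterval => f (rep (idx p.1)) p.2 :=
    hf.comp ((hψ.comp measurable_fst).prodMk measurable_snd)
  have hfψ' : Measurable fun p : Ω × unitInterval => f' (rep (idx p.1)) p.2 :=
    hf'.comp ((hψ.comp measurable_fst).prodMk measurable_snd)
  obtain ⟨q, hq⟩ := exists_kernel_eq_map (H := fun ω u => (f ω u, f (rep (idx ω)) u))
    (hf.prodMk hfψ)
  obtain ⟨q', hq'⟩ := exists_kernel_eq_map (H := fun ω u => (f' (rep (idx ω)) u, f' ω u))
    (hfψ'.prodMk hf')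
  refine ⟨idx, rep, q, q', hidx, fun ω => ⟨⟨?_, ?_⟩, ?_⟩, fun ω => ⟨⟨?_, ?_⟩, ?_⟩⟩
  · rw [hq, Measure.map_map measurable_fst (by fun_prop), ← hfζ]; rfl
  · rw [hq, Measure.map_map measurable_snd (by fun_prop), ← hfζ]; rfl
  · rw [hq, lintegral_map (by fun_prop) (by fun_prop)]
    calc ∫⁻ u, l1dist (f ω u) (f (rep (idx ω)) u)
        ≤ ∫⁻ u, (l1dist (f ω u) (g (idx ω) u) + l1dist (f (rep (idx ω)) u) (g (idx ω) u)) :=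
          lintegral_mono fun u => (l1dist_triangle _ (g (idx ω) u) _).trans_eq
            (by rw [l1dist_comm (g _ _)])
      _ ≤ ε / 2 + ε / 2 := by
          rw [lintegral_add_left (by fun_prop)]
          refine add_le_add (h1 ω) ?_
          have := h1 (rep (idx ω))
          rwa [hrep] at this
      _ = ε := ENNReal.add_halves ε
  · rw [hq', Measure.map_map measurable_fst (by fun_prop), ← hfζ']; rfl
  · rw [hq', Measure.map_map measurable_snd (by fun_prop), ← hfζ']; rfl
  · rw [hq', lintegral_map (by fun_prop) (by fun_prop)]
    calc ∫⁻ u, l1dist (f' (rep (idx ω)) u) (f' ω u)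
        ≤ ∫⁻ u, (l1dist (f' (rep (idx ω)) u) (g' (idx ω) u) + l1dist (f' ω u) (g' (idx ω) u)) :=
          lintegral_mono fun u => (l1dist_triangle _ (g' (idx ω) u) _).trans_eq
            (by rw [l1dist_comm (g' _ _)])
      _ ≤ ε / 2 + ε / 2 := by
          rw [lintegral_add_left (by fun_prop)]
          refine add_le_add ?_ (h2 ω)
          have := h2 (rep (idx ω))
          rwa [hrep] at this
      _ = ε := ENNReal.add_halves ε

/-- A Lipschitz functional changes by at most `L W` between two mixtures whose components are
pairwise within distance `W`. -/
theorem LipschitzOnD.sub_bind_le {K : Measure (Stock m) → ℝ} {L : ℝ} (hL : 0 ≤ L)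
    (hK : LipschitzOnD K L) (ρ : Measure Ω) [IsProbabilityMeasure ρ]
    (ζ ζ' : Kernel Ω (Stock m)) [IsMarkovKernel ζ] [IsMarkovKernel ζ']
    (hζ : ∀ ω, moment (ζ ω) < ∞) (hζ' : ∀ ω, moment (ζ' ω) < ∞)
    (hρ : ∫⁻ ω, moment (ζ ω) ∂ρ < ∞) (hρ' : ∫⁻ ω, moment (ζ' ω) ∂ρ < ∞)
    {W : ℝ} (hW0 : 0 ≤ W) (hW : ∀ ω, wass (ζ ω) (ζ' ω) ≤ ENNReal.ofReal W) :
    |K (ρ.bind ζ) - K (ρ.bind ζ')| ≤ L * W := by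
  have : Nonempty Ω := ρ.nonempty_of_neZero
  have hD : ∀ (ξ : Kernel Ω (Stock m)) [IsMarkovKernel ξ], ∫⁻ ω, moment (ξ ω) ∂ρ < ∞ →
      InD (ρ.bind ξ) := fun ξ _ h => .of_moment_lt (by rwa [moment_bind])
  have hstep : ∀ (ξ ξ' : Kernel Ω (Stock m)) (q : Kernel Ω (Stock m × Stock m)) (c : ℝ), 0 ≤ c →
      InD (ρ.bind ξ) → InD (ρ.bind ξ') → (∀ ω, IsCoupling (q ω) (ξ ω) (ξ' ω)) →
      (∀ ω, ∫⁻ p, l1dist p.1 p.2 ∂(q ω) ≤ ENNReal.ofReal c) →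
      |K (ρ.bind ξ) - K (ρ.bind ξ')| ≤ L * c := fun ξ ξ' q c hc h1 h2 hq hqc => by
    refine (hK _ _ h1 h2).trans (mul_le_mul_of_nonneg_left ?_ hL)
    refine ENNReal.toReal_le_of_le_ofReal hc ((wass_bind_le_of_kernel ρ ξ ξ' q hq).trans ?_)
    calc _ ≤ ∫⁻ _, ENNReal.ofReal c ∂ρ := lintegral_mono hqc
      _ = _ := by simp
  suffices h : ∀ ε : ℝ, 0 < ε → |K (ρ.bind ζ) - K (ρ.bind ζ')| ≤ L * (W + 3 * ε) by
    have hlim : Filter.Tendsto (fun ε : ℝ => L * (W + 3 * ε)) (nhdsWithin 0 (Set.Ioi 0))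
        (nhds (L * (W + 3 * 0))) :=
      Filter.Tendsto.mono_left (Continuous.tendsto (by fun_prop) 0) nhdsWithin_le_nhds
    rw [mul_zero, add_zero] at hlim
    exact ge_of_tendsto hlim (eventually_nhdsWithin_of_forall fun ε hε => h ε hε)
  -- Interpolate through `ζ ∘ ψ` and `ζ' ∘ ψ` with `ψ = rep ∘ idx`, up to an error `ε` per step.
  intro ε hε
  have hε' : ENNReal.ofReal ε ≠ 0 := by simpa using hε
  obtain ⟨idx, rep, q, q', hidx, hq, hq'⟩ := exists_countable_approx ζ ζ' hζ hζ' hε'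
  have hψ : Measurable fun ω => rep (idx ω) := (measurable_from_nat (f := rep)).comp hidx
  choose r hr hrc using fun n => exists_isCoupling_lintegral_le (hW (rep n)) (by simp) hε'
  -- The choice of near-optimal couplings is measurable because it only depends on `idx ω`.
  let qm : Kernel Ω (Stock m × Stock m) :=
    ⟨fun ω => r (idx ω), (measurable_from_nat (f := r)).comp hidx⟩
  have hm1 : ∫⁻ ω, moment (ζ.comap _ hψ ω) ∂ρ < ∞ := by
    calc ∫⁻ ω, moment (ζ.comap _ hψ ω) ∂ρ
        ≤ ∫⁻ ω, (ENNReal.ofReal ε + moment (ζ ω)) ∂ρ := by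
          refine lintegral_mono fun ω => ?_
          have h := (hq ω).1
          have h' : IsCoupling ((q ω).map Prod.swap) (ζ (rep (idx ω))) (ζ ω) := by
            refine ⟨?_, ?_⟩
            · rw [Measure.map_map measurable_fst measurable_swap]; exact h.2
            · rw [Measure.map_map measurable_snd measurable_swap]; exact h.1
          refine h'.moment_le.trans (add_le_add_left ?_ _)
          rw [lintegral_map measurable_l1dist measurable_swap]
          simp_rw [Prod.fst_swap, Prod.snd_swap, l1dist_comm _ (Prod.fst _)]
          exact (hq ω).2
      _ < ∞ := by
          rw [lintegral_add_left measurable_const]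
          simpa using hρ
  have hm2 : ∫⁻ ω, moment (ζ'.comap _ hψ ω) ∂ρ < ∞ := by
    calc ∫⁻ ω, moment (ζ'.comap _ hψ ω) ∂ρ
        ≤ ∫⁻ ω, (ENNReal.ofReal ε + moment (ζ' ω)) ∂ρ :=
          lintegral_mono fun ω => (hq' ω).1.moment_le.trans (add_le_add_left (hq' ω).2 _)
      _ < ∞ := by
          rw [lintegral_add_left measurable_const]
          simpa using hρ'
  have h1 := hstep ζ (ζ.comap _ hψ) q ε hε.le (hD _ hρ) (hD _ hm1) (fun ω => (hq ω).1)
    fun ω => (hq ω).2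
  have h2 := hstep (ζ.comap _ hψ) (ζ'.comap _ hψ) qm (W + ε) (by positivity) (hD _ hm1) (hD _ hm2)
    (fun ω => hr (idx ω))
    fun ω => (hrc (idx ω)).trans_eq (ENNReal.ofReal_add hW0 hε.le).symm
  have h3 := hstep (ζ'.comap _ hψ) ζ' q' ε hε.le (hD _ hm2) (hD _ hρ') (fun ω => (hq' ω).1)
    fun ω => (hq' ω).2
  calc |K (ρ.bind ζ) - K (ρ.bind ζ')|
      ≤ |K (ρ.bind ζ) - K (ρ.bind (ζ.comap _ hψ))|
        + |K (ρ.bind (ζ.comap _ hψ)) - K (ρ.bind (ζ'.comap _ hψ))|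
        + |K (ρ.bind (ζ'.comap _ hψ)) - K (ρ.bind ζ')| :=
        (abs_sub_le _ (K (ρ.bind (ζ'.comap _ hψ))) _).trans
          (add_le_add_left (abs_sub_le _ _ _) _)
    _ ≤ L * ε + L * (W + ε) + L * ε := add_le_add (add_le_add h1 h2) h3
    _ = L * (W + 3 * ε) := by ring

end Mixture

/-! ### Indifference to mixtures with unbounded components -/

section Mix

variable {X Y : Type*} [MeasurableSpace X] [MeasurableSpace Y]

/-- The two-point mixture `p μ + (1 - p) ν`. -/
noncomputable def mix (p : ℝ) (μ ν : Measure X) : Measure X :=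
  ENNReal.ofReal p • μ + ENNReal.ofReal (1 - p) • ν

theorem isProbabilityMeasure_mix {p : ℝ} (h0 : 0 ≤ p) (h1 : p ≤ 1) (μ ν : Measure X)
    [IsProbabilityMeasure μ] [IsProbabilityMeasure ν] : IsProbabilityMeasure (mix p μ ν) := by
  constructor
  simp only [mix, Measure.coe_add, Measure.coe_smul, Pi.add_apply, Pi.smul_apply, measure_univ,
    smul_eq_mul, mul_one]
  rw [← ENNReal.ofReal_add h0 (by linarith)]
  simp

theorem mix_zero (μ ν : Measure X) : mix 0 μ ν = ν := by simp [mix]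

theorem mix_one (μ ν : Measure X) : mix 1 μ ν = μ := by simp [mix]

theorem mix_mix_left {p t : ℝ} (hp0 : 0 ≤ p) (hp1 : p ≤ 1) (ht0 : 0 ≤ t) (ht1 : t ≤ 1)
    (μ ν : Measure X) : mix p μ (mix t μ ν) = mix (p + (1 - p) * t) μ ν := by
  have h1 : 0 ≤ 1 - p := by linarith
  have h2 : 0 ≤ 1 - t := by linarith
  rw [mix, mix, mix, ENNReal.ofReal_add hp0 (by positivity), ENNReal.ofReal_mul h1,
    show 1 - (p + (1 - p) * t) = (1 - p) * (1 - t) by ring, ENNReal.ofReal_mul h1, smul_add,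
    smul_smul, smul_smul, add_smul, add_assoc]

theorem mix_mix_right {p t : ℝ} (hp0 : 0 ≤ p) (hp1 : p ≤ 1) (ht1 : t ≤ 1)
    (μ ν : Measure X) : mix p ν (mix t μ ν) = mix ((1 - p) * t) μ ν := by
  have h1 : 0 ≤ 1 - p := by linarith
  have h2 : 0 ≤ 1 - t := by linarith
  rw [mix, mix, mix, ENNReal.ofReal_mul h1,
    show 1 - (1 - p) * t = p + (1 - p) * (1 - t) by ring, ENNReal.ofReal_add hp0 (by positivity),
    ENNReal.ofReal_mul h1, smul_add, smul_smul, smul_smul, add_smul]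
  abel

theorem mix_bind (p : ℝ) (μ ν : Measure X) (η : Kernel X Y) :
    (mix p μ ν).bind η = mix p (μ.bind η) (ν.bind η) := by
  ext s hs
  simp only [mix, Measure.bind_apply hs η.aemeasurable, lintegral_add_measure,
    lintegral_smul_measure, Measure.coe_add, Measure.coe_smul, Pi.add_apply, Pi.smul_apply]

/-- The mixture of a kernel and of a fixed measure, with state-dependent weight. -/
noncomputable def mixKernel (q : X → ℝ) (hq : Measurable q) (η : Kernel X Y) (ν : Measure Y) :
    Kernel X Y where
  toFun x := mix (q x) (η x) ν
  measurable' := by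
    refine Measure.measurable_of_measurable_coe _ fun s hs => ?_
    have := η.measurable_coe hs
    simp only [mix, Measure.coe_add, Measure.coe_smul, Pi.add_apply, Pi.smul_apply, smul_eq_mul]
    fun_prop

theorem mixKernel_apply (q : X → ℝ) (hq : Measurable q) (η : Kernel X Y) (ν : Measure Y) (x : X) :
    mixKernel q hq η ν x = mix (q x) (η x) ν := rfl

variable {m : ℕ}

theorem moment_mix (p : ℝ) (μ ν : Measure (Stock m)) :
    moment (mix p μ ν) = ENNReal.ofReal p * moment μ + ENNReal.ofReal (1 - p) * moment ν := by
  simp [moment, mix, lintegral_add_measure, lintegral_smul_measure]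

theorem InD.mix {μ ν : Measure (Stock m)} (hμ : InD μ) (hν : InD ν) {p : ℝ} (h0 : 0 ≤ p)
    (h1 : p ≤ 1) : InD (mix p μ ν) := by
  have := hμ.1
  have := hν.1
  have := isProbabilityMeasure_mix h0 h1 μ ν
  refine .of_moment_lt ?_
  rw [moment_mix]
  exact ENNReal.add_lt_top.2 ⟨ENNReal.mul_lt_top (by simp) hμ.moment_lt_top,
    ENNReal.mul_lt_top (by simp) hν.moment_lt_top⟩

/-- Size-biasing: reweighting the mixing law by `w / N` and diluting each component with weight
`1 / w` multiplies the mixture by `1 / N`. -/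
theorem withDensity_bind_mixKernel (ρ : Measure X) [IsProbabilityMeasure ρ] {w : X → ℝ}
    (hw : Measurable w) (hw1 : ∀ x, 1 ≤ w x) (hwi : Integrable w ρ) {N : ℝ} (hN : 0 < N)
    (hwN : ∫ x, w x ∂ρ = N) (η : Kernel X Y) (ν : Measure Y) :
    (ρ.withDensity fun x => ENNReal.ofReal (w x / N)).bind
      (mixKernel (fun x => 1 / w x) (by fun_prop) η ν) = mix (1 / N) (ρ.bind η) ν := by
  ext s hs
  have hη := η.measurable_coe hs
  rw [Measure.bind_apply hs (Kernel.aemeasurable _),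
    lintegral_withDensity_eq_lintegral_mul _ (by fun_prop) (Kernel.measurable_coe _ hs)]
  have h1 : ∀ x, ENNReal.ofReal (w x / N) * mixKernel (fun x => 1 / w x) (by fun_prop) η ν x s =
      ENNReal.ofReal (1 / N) * η x s + ENNReal.ofReal (w x / N - 1 / N) * ν s := fun x => by
    have hx : 0 < w x := zero_lt_one.trans_le (hw1 x)
    simp only [mixKernel_apply, mix, Measure.coe_add, Measure.coe_smul, Pi.add_apply,
      Pi.smul_apply, smul_eq_mul, mul_add, ← mul_assoc]
    rw [← ENNReal.ofReal_mul (by positivity), ← ENNReal.ofReal_mul (by positivity)]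
    congr 3
    · field_simp
    · field_simp
  have h2 : ∫⁻ x, ENNReal.ofReal (w x / N - 1 / N) ∂ρ = ENNReal.ofReal (1 - 1 / N) := by
    rw [← ofReal_integral_eq_lintegral_ofReal (f := fun x => w x / N - 1 / N)
      ((hwi.div_const N).sub (integrable_const _))
      (.of_forall fun x => sub_nonneg.2 (by gcongr; exact hw1 x)),
      integral_sub (hwi.div_const N) (integrable_const _), integral_div, hwN, div_self hN.ne']
    simp
  simp only [Pi.mul_apply, h1]
  rw [lintegral_add_left (by fun_prop), lintegral_const_mul _ hη,
    lintegral_mul_const _ (by fun_prop), h2]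
  simp [mix, Measure.bind_apply hs η.aemeasurable]

theorem isProbabilityMeasure_withDensity_div (ρ : Measure X) {w : X → ℝ} (hw1 : ∀ x, 1 ≤ w x)
    (hwi : Integrable w ρ) {N : ℝ} (hN : 0 < N) (hwN : ∫ x, w x ∂ρ = N) :
    IsProbabilityMeasure (ρ.withDensity fun x => ENNReal.ofReal (w x / N)) := by
  constructor
  rw [withDensity_apply _ MeasurableSet.univ, setLIntegral_univ,
    ← ofReal_integral_eq_lintegral_ofReal (hwi.div_const N)
      (.of_forall fun x => div_nonneg (zero_le_one.trans (hw1 x)) hN.le),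
    integral_div, hwN, div_self hN.ne', ENNReal.ofReal_one]

end Mix

section Indifference

variable {S : Type u} [MeasurableSpace S] {m : ℕ} {K : Measure (Stock m) → ℝ}

theorem supWass_dirac_lt_top {η : Kernel (Aug S m) (Stock m)} [IsMarkovKernel η] {B : ℝ≥0∞}
    (hB : B < ∞) (h : ∀ x, moment (η x) ≤ B) : supWass η (fun _ => Measure.dirac 0) < ∞ :=
  (iSup_le fun x => (wass_dirac_zero (η x)).trans_le (h x)).trans_lt hB

/-- The independence axiom: preferences are preserved when mixing with a third distribution. -/
theorem IndifferentToMixtures.mix_le (hmix : IndifferentToMixtures S K) [Nonempty S] (hm : 0 < m)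
    {μ μ' ν : Measure (Stock m)} (hμ : InD μ) (hμ' : InD μ') (hν : InD ν) (h : K μ' ≤ K μ)
    {p : ℝ} (h0 : 0 ≤ p) (h1 : p ≤ 1) : K (mix p μ' ν) ≤ K (mix p μ ν) := by
  classical
  have := hμ.1
  have := hμ'.1
  have := hν.1
  obtain ⟨s⟩ := ‹Nonempty S›
  -- Two augmented states are told apart by the sign of a coordinate of the stock.
  have hE : MeasurableSet {x : Aug S m | 0 < x.2 ⟨0, hm⟩} :=
    measurableSet_lt measurable_const (by fun_prop)
  let η (ξ : Measure (Stock m)) := Kernel.piecewise hE (Kernel.const (Aug S m) ξ) (Kernel.const _ ν)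
  have hη : ∀ ξ, (mix p (Measure.dirac ((s, fun _ => 1) : Aug S m))
      (Measure.dirac (s, fun _ => 0))).bind (η ξ) = mix p ξ ν := fun ξ => by
    rw [mix_bind, Measure.dirac_bind (Kernel.measurable _),
      Measure.dirac_bind (Kernel.measurable _)]
    simp [η, Kernel.piecewise_apply]
  have hB : ∀ ξ, InD ξ → supWass (η ξ) (fun _ => Measure.dirac 0) < ∞ := fun ξ hξ => by
    have := hξ.1
    refine supWass_dirac_lt_top (B := moment ξ + moment ν)
      (ENNReal.add_lt_top.2 ⟨hξ.moment_lt_top, hν.moment_lt_top⟩) fun x => ?_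
    simp only [η, Kernel.piecewise_apply, Kernel.const_apply]
    split_ifs
    · exact le_self_add
    · exact le_add_self
  rw [← hη μ, ← hη μ']
  refine hmix (η μ) (η μ') inferInstance inferInstance (hB μ hμ) (hB μ' hμ') (fun x => ?_) _
    (isProbabilityMeasure_mix h0 h1 _ _)
  simp only [η, Kernel.piecewise_apply, Kernel.const_apply]
  split_ifs
  · exact h
  · exact le_rfl

/-- Preferences that survive a dilution by a fixed weight `1 / N`, whatever the third distribution,
hold without dilution: pass from `ν'` to `ν` in `N` steps, replacing a mass `1 / N` at a time. -/
theorem le_of_forall_mix_le {ν ν' : Measure (Stock m)} (hν : InD ν) (hν' : InD ν') {N : ℕ}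
    (hN : 2 ≤ N)
    (h : ∀ ξ, InD ξ → K (mix (1 / (N : ℝ)) ν' ξ) ≤ K (mix (1 / (N : ℝ)) ν ξ)) : K ν' ≤ K ν := by
  have hN' : (2 : ℝ) ≤ N := by exact_mod_cast hN
  have key : ∀ k : ℕ, k ≤ N → K ν' ≤ K (mix ((k : ℝ) / N) ν ν') := by
    intro k
    induction k with
    | zero => intro _; simp [mix_zero]
    | succ k ih =>
      intro hk
      have hk' : (k : ℝ) + 1 ≤ N := by exact_mod_cast hk
      have hp0 : (0 : ℝ) ≤ 1 / N := by positivity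
      have hp1 : (1 : ℝ) / N ≤ 1 := by rw [div_le_one (by linarith)]; linarith
      have ht0 : (0 : ℝ) ≤ k / (N - 1) := div_nonneg (by positivity) (by linarith)
      have ht1 : (k : ℝ) / (N - 1) ≤ 1 := by rw [div_le_one (by linarith)]; linarith
      have hne : (N : ℝ) - 1 ≠ 0 := by linarith
      have hne' : (N : ℝ) ≠ 0 := by linarith
      -- The third distribution puts weight `t = k / (N - 1)` on `ν`:
      -- then `(1 - 1 / N) t = k / N`.
      have := h _ (hν.mix hν' ht0 ht1)
      rw [mix_mix_left hp0 hp1 ht0 ht1, mix_mix_right hp0 hp1 ht1,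
        show (1 - 1 / (N : ℝ)) * (k / (N - 1)) = k / N by field_simp,
        show 1 / (N : ℝ) + k / N = ((k + 1 : ℕ) : ℝ) / N by push_cast; ring] at this
      exact (ih (by omega)).trans this
  have := key N le_rfl
  rwa [div_self (by linarith), mix_one] at this

/-- Indifference to mixtures extends from uniformly bounded families of distributions to mixtures
whose first moment is merely integrable. This is what the translated returns `c + G(s, c)` need,
as the stock `c` is unbounded. -/
theorem IndifferentToMixtures.bind_le (hmix : IndifferentToMixtures S K)
    (ζ ζ' : Kernel (Aug S m) (Stock m)) [IsMarkovKernel ζ] [IsMarkovKernel ζ']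
    (hζ : ∀ x, moment (ζ x) < ∞) (hζ' : ∀ x, moment (ζ' x) < ∞)
    (ρ : Measure (Aug S m)) [IsProbabilityMeasure ρ]
    (hρ : ∫⁻ x, moment (ζ x) ∂ρ < ∞) (hρ' : ∫⁻ x, moment (ζ' x) ∂ρ < ∞)
    (h : ∀ x, K (ζ' x) ≤ K (ζ x)) : K (ρ.bind ζ') ≤ K (ρ.bind ζ) := by
  rcases Nat.eq_zero_or_pos m with rfl | hm
  · -- All probability distributions on `ℝ⁰` coincide.
    have : ρ.bind ζ' = ρ.bind ζ := by
      ext s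
      induction s using Subsingleton.set_cases <;> simp
    rw [this]
  have : Nonempty S := ⟨(ρ.nonempty_of_neZero).some.1⟩
  have hD : ∀ (ξ : Kernel (Aug S m) (Stock m)) [IsMarkovKernel ξ], ∫⁻ ω, moment (ξ ω) ∂ρ < ∞ →
      InD (ρ.bind ξ) := fun ξ _ h => .of_moment_lt (by rwa [moment_bind])
  let b : Aug S m → ℝ := fun x => (moment (ζ x) + moment (ζ' x)).toReal
  have hbm : Measurable b := ((measurable_moment ζ).add (measurable_moment ζ')).ennreal_toReal
  have hbi : Integrable b ρ := by
    refine integrable_toReal_of_lintegral_ne_top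
      ((measurable_moment ζ).add (measurable_moment ζ')).aemeasurable ?_
    rw [lintegral_add_left (measurable_moment ζ)]
    exact (ENNReal.add_lt_top.2 ⟨hρ, hρ'⟩).ne
  obtain ⟨N, hN⟩ := exists_nat_ge (∫ x, b x ∂ρ + 1 + 1)
  have hb0 : ∀ x, 0 ≤ b x := fun x => ENNReal.toReal_nonneg
  have hI0 : 0 ≤ ∫ x, b x ∂ρ := integral_nonneg hb0
  have hN2 : (2 : ℝ) ≤ N := by linarith
  -- The constant is chosen so that `w` has mean `N` and is at least `1` plus the moments.
  let w : Aug S m → ℝ := fun x => (N - ∫ x, b x ∂ρ) + b x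
  have hw : Measurable w := by fun_prop
  have hw1 : ∀ x, 1 ≤ w x := fun x => by have := hb0 x; simp only [w]; linarith
  have hwi : Integrable w ρ := (integrable_const _).add hbi
  have hwN : ∫ x, w x ∂ρ = N := by
    simp only [w]
    rw [integral_add (integrable_const _) hbi]
    simp
  have hq0 : ∀ x, 0 ≤ 1 / w x := fun x => by have := hw1 x; positivity
  have hq1 : ∀ x, 1 / w x ≤ 1 := fun x => by
    have := hw1 x
    rw [div_le_one (by linarith)]; exact this
  refine le_of_forall_mix_le (hD ζ hρ) (hD ζ' hρ') (N := N) (by exact_mod_cast hN2) fun ξ hξ => ?_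
  have hξp := hξ.1
  have hMk : ∀ (κ : Kernel (Aug S m) (Stock m)) [IsMarkovKernel κ],
      IsMarkovKernel (mixKernel (fun x => 1 / w x) (by fun_prop) κ ξ) := fun κ _ =>
    ⟨fun x => isProbabilityMeasure_mix (hq0 x) (hq1 x) _ _⟩
  have hsup : ∀ (κ : Kernel (Aug S m) (Stock m)) [IsMarkovKernel κ],
      (∀ x, moment (κ x) ≤ ENNReal.ofReal (w x)) →
      supWass (mixKernel (fun x => 1 / w x) (by fun_prop) κ ξ) (fun _ => Measure.dirac 0) < ∞ :=
    fun κ _ hκ => by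
    have := hMk κ
    refine supWass_dirac_lt_top (B := 1 + moment ξ)
      (ENNReal.add_lt_top.2 ⟨by simp, hξ.moment_lt_top⟩) fun x => ?_
    rw [mixKernel_apply, moment_mix]
    refine add_le_add ?_ ?_
    · calc ENNReal.ofReal (1 / w x) * moment (κ x)
          ≤ ENNReal.ofReal (1 / w x) * ENNReal.ofReal (w x) := by gcongr; exact hκ x
        _ = 1 := by
          have := hw1 x
          rw [← ENNReal.ofReal_mul (hq0 x), one_div_mul_cancel (by linarith), ENNReal.ofReal_one]
    · refine mul_le_of_le_one_left' ?_
      rw [← ENNReal.ofReal_one]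
      exact ENNReal.ofReal_le_ofReal (by linarith [hq0 x])
  have hbw : ∀ x, moment (ζ x) + moment (ζ' x) ≤ ENNReal.ofReal (w x) := fun x => by
    rw [← ENNReal.ofReal_toReal (ENNReal.add_lt_top.2 ⟨hζ x, hζ' x⟩).ne]
    exact ENNReal.ofReal_le_ofReal (by simp only [w, b]; linarith)
  have hNp : (0 : ℝ) < N := by linarith
  rw [← withDensity_bind_mixKernel ρ hw hw1 hwi hNp hwN,
    ← withDensity_bind_mixKernel ρ hw hw1 hwi hNp hwN]
  exact hmix _ _ (hMk ζ) (hMk ζ') (hsup ζ fun x => le_self_add.trans (hbw x))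
    (hsup ζ' fun x => le_add_self.trans (hbw x))
    (fun x => hmix.mix_le hm (.of_moment_lt (hζ x)) (.of_moment_lt (hζ' x)) hξ (h x)
      (hq0 x) (hq1 x))
    _ (isProbabilityMeasure_withDensity_div ρ hw1 hwi hNp hwN)

end Indifference

/-! ### Laws of states and actions along trajectories -/

section Laws

variable {S A : Type u} [MeasurableSpace S] [MeasurableSpace A] {m : ℕ}

/-- The action contained in an observation made after time `0`. -/
def Obs.action (n : ℕ) (o : Obs S A m (n + 1)) : A := o.1

theorem Obs.measurable_action (n : ℕ) : Measurable (Obs.action (S := S) (A := A) (m := m) n) :=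
  (measurable_fst : Measurable fun o : A × Stock m × Aug S m => o.1)

/-- The augmented state at time `t` of a trajectory. -/
def stateAt (t : ℕ) (ω : Traj S A m) : Aug S m := Obs.state t (ω t)

/-- The reward `R_{t+1}` of a trajectory. -/
def rewardAt (t : ℕ) (ω : Traj S A m) : Stock m := Obs.reward t (ω (t + 1))

/-- The action `A_t` of a trajectory. -/
def actionAt (t : ℕ) (ω : Traj S A m) : A := Obs.action t (ω (t + 1))

@[fun_prop]
theorem measurable_stateAt (t : ℕ) : Measurable (stateAt (S := S) (A := A) (m := m) t) :=
  (Obs.measurable_state t).comp (measurable_pi_apply t)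

@[fun_prop]
theorem measurable_rewardAt (t : ℕ) : Measurable (rewardAt (S := S) (A := A) (m := m) t) :=
  (Obs.measurable_reward t).comp (measurable_pi_apply (t + 1))

@[fun_prop]
theorem measurable_actionAt (t : ℕ) : Measurable (actionAt (S := S) (A := A) (m := m) t) :=
  (Obs.measurable_action t).comp (measurable_pi_apply (t + 1))

namespace MDP

variable (M : MDP S A m)

theorem lintegral_augDyn (p : Aug S m × A) {F : Stock m × Aug S m → ℝ≥0∞} (hF : Measurable F) :
    ∫⁻ y, F y ∂(M.augDyn p) =
      ∫⁻ z, F (z.1, (z.2, M.γ⁻¹ • (p.1.2 + z.1))) ∂(M.dyn (p.1.1, p.2)) := by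
  rw [augDyn, Kernel.lintegral_map _ (by fun_prop) _ hF, Kernel.prod_apply, Kernel.id_apply,
    Measure.dirac_prod, lintegral_map (by fun_prop) (by fun_prop)]
  rfl

/-- The law of `(S_t, C_t)`. -/
noncomputable def stateLaw (π : HistoryPolicy S A m) (t : ℕ) (x : Aug S m) : Measure (Aug S m) :=
  (M.traj π x).map (stateAt t)

/-- The joint law of `(S_t, C_t)` and `A_t`. -/
noncomputable def actLaw (π : HistoryPolicy S A m) (t : ℕ) (x : Aug S m) :
    Measure (Aug S m × A) :=
  (M.traj π x).map fun ω => (stateAt t ω, actionAt t ω)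

instance (π : HistoryPolicy S A m) (t : ℕ) (x : Aug S m) :
    IsProbabilityMeasure (M.stateLaw π t x) :=
  Measure.isProbabilityMeasure_map (by fun_prop)

instance (π : HistoryPolicy S A m) (t : ℕ) (x : Aug S m) :
    IsProbabilityMeasure (M.actLaw π t x) :=
  Measure.isProbabilityMeasure_map (by fun_prop)

theorem fst_actLaw (π : HistoryPolicy S A m) (t : ℕ) (x : Aug S m) :
    (M.actLaw π t x).fst = M.stateLaw π t x := by
  rw [Measure.fst, actLaw, Measure.map_map measurable_fst (by fun_prop)]
  rfl

theorem stateLaw_zero (π : HistoryPolicy S A m) (x : Aug S m) :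
    M.stateLaw π 0 x = Measure.dirac x := by
  have h : stateAt (S := S) (A := A) (m := m) 0 = Hist.last 0 ∘ Preorder.frestrictLe 0 := rfl
  rw [stateLaw, h, ← Measure.map_map (Hist.measurable_last 0) (Preorder.measurable_frestrictLe 0),
    traj, Kernel.comap_apply, Kernel.traj_map_frestrictLe_apply, Kernel.partialTraj_self,
    Kernel.id_apply]
  exact Measure.map_dirac' (Hist.measurable_last 0) _

/-- Conditionally on the history, a transition draws an action from the policy and then follows the
dynamics. -/
theorem lintegral_history_transition (π : HistoryPolicy S A m) (t : ℕ) (x : Aug S m)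
    {G : Aug S m × A × Stock m × Aug S m → ℝ≥0∞} (hG : Measurable G) :
    ∫⁻ ω, G (stateAt t ω, actionAt t ω, rewardAt t ω, stateAt (t + 1) ω) ∂(M.traj π x) =
      ∫⁻ ω, ∫⁻ a, ∫⁻ y, G (stateAt t ω, a, y) ∂(M.augDyn (stateAt t ω, a))
        ∂(π.act t (Preorder.frestrictLe t ω)) ∂(M.traj π x) := by
  have hlast := Hist.measurable_last (S := S) (A := A) (m := m) t
  let F : Hist S A m t × (A × Stock m × Aug S m) → ℝ≥0∞ := fun p => G (Hist.last t p.1, p.2)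
  have hF : Measurable F := by fun_prop
  let k : Kernel (Hist S A m t × A) (Stock m × Aug S m) :=
    M.augDyn.comap (fun p : Hist S A m t × A => (Hist.last t p.1, p.2))
      ((hlast.comp measurable_fst).prodMk measurable_snd)
  have hstep : ∀ h : Hist S A m t, ∫⁻ o, F (h, o) ∂((π.act t ⊗ₖ k) h) =
      ∫⁻ a, ∫⁻ y, G (Hist.last t h, a, y) ∂(M.augDyn (Hist.last t h, a)) ∂(π.act t h) := fun h => by
    rw [Kernel.lintegral_compProd _ _ _ (by fun_prop)]
    rfl
  have hmap := Kernel.partialTraj_compProd_eq_map_traj (κ := M.step π) (Nat.zero_le t)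
    (x₀ := initHist x)
  have h1 : ∫⁻ p, F p ∂((Kernel.partialTraj (M.step π) 0 t (initHist x)) ⊗ₘ (π.act t ⊗ₖ k)) =
      ∫⁻ ω, G (stateAt t ω, actionAt t ω, rewardAt t ω, stateAt (t + 1) ω) ∂(M.traj π x) := by
    refine Eq.trans (congrArg (fun μ => lintegral μ F) hmap) ?_
    exact lintegral_map hF
      ((Preorder.measurable_frestrictLe t).prodMk (measurable_pi_apply (t + 1)))
  rw [← h1, Measure.lintegral_compProd hF]
  simp_rw [hstep]
  rw [← Kernel.traj_map_frestrictLe_apply, lintegral_map _ (Preorder.measurable_frestrictLe t)]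
  · rfl
  · have hin : Measurable fun p : Hist S A m t × A => ∫⁻ y, G (Hist.last t p.1, p.2, y) ∂(k p) :=
      Measurable.lintegral_kernel_prod_right' (κ := k)
        (f := fun p => G (Hist.last t p.1.1, p.1.2, p.2)) (by fun_prop)
    exact hin.lintegral_kernel_prod_right' (κ := π.act t)

theorem lintegral_actLaw (π : HistoryPolicy S A m) (t : ℕ) (x : Aug S m)
    {g : Aug S m × A → ℝ≥0∞} (hg : Measurable g) :
    ∫⁻ p, g p ∂(M.actLaw π t x) = ∫⁻ ω, ∫⁻ a, g (stateAt t ω, a)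
      ∂(π.act t (Preorder.frestrictLe t ω)) ∂(M.traj π x) := by
  rw [actLaw, lintegral_map hg (by fun_prop)]
  have := M.lintegral_history_transition π t x (G := fun p => g (p.1, p.2.1)) (by fun_prop)
  simpa using this

/-- A transition follows the dynamics from the current augmented state and action. -/
theorem lintegral_transition (π : HistoryPolicy S A m) (t : ℕ) (x : Aug S m)
    {G : Aug S m × A × Stock m × Aug S m → ℝ≥0∞} (hG : Measurable G) :
    ∫⁻ ω, G (stateAt t ω, actionAt t ω, rewardAt t ω, stateAt (t + 1) ω) ∂(M.traj π x) =
      ∫⁻ p, ∫⁻ y, G (p.1, p.2, y) ∂(M.augDyn p) ∂(M.actLaw π t x) := by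
  rw [M.lintegral_history_transition π t x hG, M.lintegral_actLaw π t x]
  exact Measurable.lintegral_kernel_prod_right' (κ := M.augDyn)
    (f := fun p => G (p.1.1, p.1.2, p.2)) (by fun_prop)

theorem stateLaw_succ (π : HistoryPolicy S A m) (t : ℕ) (x : Aug S m) :
    M.stateLaw π (t + 1) x = (M.actLaw π t x).bind (M.augDyn.map Prod.snd) := by
  refine Measure.ext_of_lintegral _ fun f hf => ?_
  rw [stateLaw, lintegral_map hf (by fun_prop),
    Measure.lintegral_bind (Kernel.aemeasurable _) hf.aemeasurable,
    M.lintegral_transition π t x (G := fun p => f p.2.2.2) (by fun_prop)]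
  simp_rw [Kernel.lintegral_map _ measurable_snd _ hf]

theorem actLaw_toHistory (σ : MarkovPolicy S A m) (t : ℕ) (x : Aug S m) :
    M.actLaw σ.toHistory t x = M.stateLaw σ.toHistory t x ⊗ₘ (σ t).act := by
  refine Measure.ext_of_lintegral _ fun f hf => ?_
  rw [M.lintegral_actLaw _ _ _ hf, Measure.lintegral_compProd hf, stateLaw,
    lintegral_map _ (by fun_prop)]
  · rfl
  · exact Measurable.lintegral_kernel_prod_right' (κ := (σ t).act) hf

/-- The one-step kernel of the augmented state under a stationary policy. -/
noncomputable def stateStep (π : StationaryPolicy S A m) : Kernel (Aug S m) (Aug S m) :=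
  M.augDyn.map Prod.snd ∘ₖ (Kernel.id ×ₖ π.act)

/-- The kernel giving the law of `(S_t, C_t)` under a Markov policy. -/
noncomputable def marg (σ : MarkovPolicy S A m) : ℕ → Kernel (Aug S m) (Aug S m)
  | 0 => Kernel.id
  | t + 1 => M.stateStep (σ t) ∘ₖ marg σ t

theorem marg_add (σ : MarkovPolicy S A m) (n t : ℕ) :
    M.marg σ (n + t) = M.marg (fun k => σ (n + k)) t ∘ₖ M.marg σ n := by
  induction t with
  | zero => simp [marg]
  | succ t ih => rw [← add_assoc, marg, ih, marg, Kernel.comp_assoc]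

theorem compProd_bind_eq (π : StationaryPolicy S A m) (μ : Measure (Aug S m)) [SFinite μ] :
    (μ ⊗ₘ π.act).bind (M.augDyn.map Prod.snd) = μ.bind (M.stateStep π) := by
  rw [Measure.compProd_eq_comp_prod, stateStep, Measure.comp_assoc]

theorem stateLaw_toHistory (σ : MarkovPolicy S A m) (t : ℕ) (x : Aug S m) :
    M.stateLaw σ.toHistory t x = M.marg σ t x := by
  induction t with
  | zero => rw [stateLaw_zero, marg, Kernel.id_apply]
  | succ t ih =>
    rw [stateLaw_succ, actLaw_toHistory, compProd_bind_eq, ih, marg, Kernel.comp_apply]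

instance (σ : MarkovPolicy S A m) (t : ℕ) : IsMarkovKernel (M.marg σ t) :=
  ⟨fun x => by rw [← stateLaw_toHistory]; infer_instance⟩

/-- For a given initial augmented state, a Markov policy reproduces the laws of the augmented states
under any history-based policy: choose `A_t` from its conditional law given `(S_t, C_t)`. -/
theorem exists_markov_stateLaw_eq [Finite A] [MeasurableSingletonClass A]
    (π : HistoryPolicy S A m) (x : Aug S m) :
    ∃ σ : MarkovPolicy S A m, ∀ t, M.stateLaw σ.toHistory t x = M.stateLaw π t x := by
  have : Nonempty A := (π.act 0 (initHist x)).nonempty_of_neZero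
  refine ⟨fun t => ⟨(M.actLaw π t x).condKernel, inferInstance⟩, fun t => ?_⟩
  induction t with
  | zero => rw [stateLaw_zero, stateLaw_zero]
  | succ t ih =>
    rw [stateLaw_succ, stateLaw_succ, actLaw_toHistory, ih, ← fst_actLaw, Measure.disintegrate]

/-! ### The stock as a record of past rewards -/

theorem ae_stock_succ (π : HistoryPolicy S A m) (t : ℕ) (x : Aug S m) :
    ∀ᵐ ω ∂(M.traj π x),
      (stateAt (t + 1) ω).2 = M.γ⁻¹ • ((stateAt t ω).2 + rewardAt t ω) := by
  let E : Set (Aug S m × A × Stock m × Aug S m) :=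
    {p | ¬ p.2.2.2.2 = M.γ⁻¹ • (p.1.2 + p.2.2.1)}
  have hE : Measurable (E.indicator (fun _ => (1 : ℝ≥0∞))) :=
    measurable_const.indicator (measurableSet_eq_fun (by fun_prop) (by fun_prop)).compl
  have h := M.lintegral_transition π t x hE
  have h0 : ∀ p : Aug S m × A, ∫⁻ y, E.indicator (fun _ => (1 : ℝ≥0∞)) (p.1, p.2, y)
      ∂(M.augDyn p) = 0 := fun p => by
    rw [M.lintegral_augDyn p (F := fun y => E.indicator (fun _ => (1 : ℝ≥0∞)) (p.1, p.2, y))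
      (hE.comp (by fun_prop))]
    simp [E, Set.indicator]
  simp_rw [h0, lintegral_zero] at h
  filter_upwards [(lintegral_eq_zero_iff' (hE.comp (by fun_prop)).aemeasurable).1 h] with ω hω
  simp only [Set.indicator, Set.mem_ofPred_eq, E, Pi.zero_apply, ite_eq_right_iff, one_ne_zero,
    imp_false, not_not, Function.comp_apply] at hω
  exact hω

theorem ae_stateAt_zero_stock (π : HistoryPolicy S A m) (x : Aug S m) :
    ∀ᵐ ω ∂(M.traj π x), (stateAt 0 ω).2 = x.2 := by
  have h : ∀ᵐ y ∂(M.stateLaw π 0 x), y.2 = x.2 := by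
    rw [stateLaw_zero]
    exact (ae_dirac_iff (measurableSet_eq_fun measurable_snd measurable_const)).2 rfl
  exact ae_of_ae_map (by fun_prop) h

/-- The discounted stock is the initial stock plus the discounted rewards collected so far. -/
theorem ae_smul_stock_eq (π : HistoryPolicy S A m) (x : Aug S m) :
    ∀ᵐ ω ∂(M.traj π x), ∀ t, M.γ ^ t • (stateAt t ω).2 =
      x.2 + ∑ k ∈ Finset.range t, M.γ ^ k • rewardAt k ω := by
  filter_upwards [M.ae_stateAt_zero_stock π x, ae_all_iff.2 fun t => M.ae_stock_succ π t x]
    with ω h0 hs t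
  induction t with
  | zero => simp [h0]
  | succ t ih =>
    rw [hs, smul_smul, pow_succ, mul_assoc, mul_inv_cancel₀ M.γ_pos.ne', mul_one, smul_add, ih,
      Finset.sum_range_succ, add_assoc]

end MDP

end Laws

/-! ### Expected rewards and terminal states -/

namespace MDP

section Rewards

variable {S A : Type u} [MeasurableSpace S] [MeasurableSpace A] {m : ℕ} (M : MDP S A m)

/-- The expected size `𝔼 ‖R_{t+1}‖₁` of a reward. -/
noncomputable def expReward (π : HistoryPolicy S A m) (t : ℕ) (x : Aug S m) : ℝ≥0∞ :=
  ∫⁻ ω, l1dist (rewardAt t ω) 0 ∂(M.traj π x)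

/-- The largest expected size of a reward that can be achieved `k` steps after being in a state. -/
noncomputable def worstReward : ℕ → S → ℝ≥0∞
  | 0, s => ⨆ a, ∫⁻ y, l1dist y.1 0 ∂(M.dyn (s, a))
  | k + 1, s => ⨆ a, ∫⁻ y, worstReward k y.2 ∂(M.dyn (s, a))

theorem measurable_worstReward [Countable A] (k : ℕ) : Measurable (M.worstReward k) := by
  induction k with
  | zero =>
    refine Measurable.iSup fun a => ?_
    exact (Measurable.lintegral_kernel (κ := M.dyn) (by fun_prop)).comp measurable_prodMk_right
  | succ k ih =>
    refine Measurable.iSup fun a => ?_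
    exact (Measurable.lintegral_kernel (κ := M.dyn) (f := fun y => M.worstReward k y.2)
      (by fun_prop)).comp measurable_prodMk_right

theorem worstReward_zero_le (s : S) :
    M.worstReward 0 s ≤ ⨆ p : S × A, ∫⁻ y, l1dist y.1 0 ∂(M.dyn p) :=
  iSup_le fun a => le_iSup (fun p : S × A => ∫⁻ y, l1dist y.1 0 ∂(M.dyn p)) (s, a)

theorem worstReward_eq_zero_of_isTerminal [Countable A] {s : S} (hs : M.IsTerminal s) (k : ℕ) :
    M.worstReward k s = 0 := by
  induction k with
  | zero =>
    simp only [worstReward, hs _]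
    simp_rw [lintegral_dirac' (f := fun y : Stock m × S => l1dist y.1 0) (0, s) (by fun_prop)]
    simp [l1dist_self]
  | succ k ih =>
    have := M.measurable_worstReward k
    simp only [worstReward, hs _]
    simp_rw [lintegral_dirac' (f := fun y : Stock m × S => M.worstReward k y.2) (0, s)
      (by fun_prop)]
    simp [ih]

theorem lintegral_worstReward_succ_le [Countable A] (π : HistoryPolicy S A m) (k t : ℕ)
    (x : Aug S m) :
    ∫⁻ y, M.worstReward k y.1 ∂(M.stateLaw π (t + 1) x) ≤
      ∫⁻ y, M.worstReward (k + 1) y.1 ∂(M.stateLaw π t x) := by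
  have hk := M.measurable_worstReward k
  have hk' := M.measurable_worstReward (k + 1)
  rw [stateLaw, lintegral_map (by fun_prop) (by fun_prop),
    M.lintegral_transition π t x (G := fun p => M.worstReward k p.2.2.2.1) (by fun_prop),
    ← fst_actLaw, Measure.fst, lintegral_map (by fun_prop) measurable_fst]
  refine lintegral_mono fun p => ?_
  rw [M.lintegral_augDyn p (F := fun y => M.worstReward k y.2.1) (by fun_prop)]
  exact le_iSup (fun a => ∫⁻ y, M.worstReward k y.2 ∂(M.dyn (p.1.1, a))) p.2

theorem expReward_le_lintegral_worstReward_zero [Countable A] (π : HistoryPolicy S A m) (t : ℕ)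
    (x : Aug S m) :
    M.expReward π t x ≤ ∫⁻ y, M.worstReward 0 y.1 ∂(M.stateLaw π t x) := by
  have hk := M.measurable_worstReward 0
  rw [expReward, M.lintegral_transition π t x (G := fun p => l1dist p.2.2.1 0) (by fun_prop),
    ← fst_actLaw, Measure.fst, lintegral_map (by fun_prop) measurable_fst]
  refine lintegral_mono fun p => ?_
  rw [M.lintegral_augDyn p (F := fun y => l1dist y.1 0) (by fun_prop)]
  exact le_iSup (fun a => ∫⁻ y, l1dist y.1 0 ∂(M.dyn (p.1.1, a))) p.2

theorem expReward_add_le [Countable A] (π : HistoryPolicy S A m) (t k : ℕ) (x : Aug S m) :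
    M.expReward π (t + k) x ≤ ∫⁻ y, M.worstReward k y.1 ∂(M.stateLaw π t x) := by
  have h : ∀ k t j, ∫⁻ y, M.worstReward j y.1 ∂(M.stateLaw π (t + k) x) ≤
      ∫⁻ y, M.worstReward (j + k) y.1 ∂(M.stateLaw π t x) := by
    intro k
    induction k with
    | zero => intro t j; exact le_rfl
    | succ k ih =>
      intro t j
      refine (M.lintegral_worstReward_succ_le π j (t + k) x).trans ((ih t (j + 1)).trans_eq ?_)
      rw [add_right_comm, add_assoc]
  have := (M.expReward_le_lintegral_worstReward_zero π (t + k) x).trans (h k t 0)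
  rwa [zero_add] at this

theorem expReward_le [Countable A] (π : HistoryPolicy S A m) (t : ℕ) (x : Aug S m) :
    M.expReward π t x ≤ ⨆ p : S × A, ∫⁻ y, l1dist y.1 0 ∂(M.dyn p) :=
  calc M.expReward π t x ≤ ∫⁻ y, M.worstReward 0 y.1 ∂(M.stateLaw π t x) :=
        M.expReward_le_lintegral_worstReward_zero π t x
    _ ≤ ∫⁻ _, (⨆ p : S × A, ∫⁻ y, l1dist y.1 0 ∂(M.dyn p)) ∂(M.stateLaw π t x) :=
        lintegral_mono fun y => M.worstReward_zero_le y.1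
    _ = _ := by simp

theorem expReward_eq_zero_of_isTerminal [Countable A] (π : HistoryPolicy S A m) (t : ℕ)
    {x : Aug S m} (hx : M.IsTerminal x.1) : M.expReward π t x = 0 := by
  have h := M.expReward_add_le π 0 t x
  have hk := M.measurable_worstReward t
  rw [stateLaw_zero, lintegral_dirac' _ (by fun_prop),
    M.worstReward_eq_zero_of_isTerminal hx, zero_add] at h
  exact le_antisymm h zero_le

/-- The set of terminal states need not be measurable, so that the absence of rewards after the
horizon is derived from the vanishing of the measurable functions `worstReward`. -/
theorem TerminatesBy.expReward_eq_zero [Countable A] {M : MDP S A m} {N : ℕ}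
    (hN : M.TerminatesBy N) (π : HistoryPolicy S A m) {t : ℕ} (ht : N ≤ t) (x : Aug S m) :
    M.expReward π t x = 0 := by
  obtain ⟨k, rfl⟩ := Nat.exists_eq_add_of_le ht
  have h := M.expReward_add_le π N k x
  have hk := M.measurable_worstReward k
  rw [stateLaw, lintegral_map (by fun_prop) (by fun_prop)] at h
  refine le_antisymm (h.trans_eq ?_) zero_le
  refine (lintegral_congr_ae ?_).trans lintegral_zero
  filter_upwards [hN π x] with ω hω
  exact M.worstReward_eq_zero_of_isTerminal hω k

theorem ae_rewardAt_eq_zero {π : HistoryPolicy S A m} {t : ℕ} {x : Aug S m}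
    (h : M.expReward π t x = 0) : ∀ᵐ ω ∂(M.traj π x), rewardAt t ω = 0 := by
  filter_upwards [(lintegral_eq_zero_iff (by fun_prop)).1 h] with ω hω
  have := enorm_le_l1dist (rewardAt t ω)
  rw [hω] at this
  simpa using this

/-! ### Returns -/

/-- The expected sum of the sizes of the discounted rewards is at most `B`, for every policy. -/
def ReturnsBoundedBy (B : ℝ≥0∞) : Prop :=
  ∀ (π : HistoryPolicy S A m) (x : Aug S m), ∑' t, ‖M.γ‖ₑ ^ t * M.expReward π t x ≤ B

theorem enorm_discount_le_one : ‖M.γ‖ₑ ≤ 1 := by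
  rw [Real.enorm_of_nonneg M.γ_pos.le]
  exact ENNReal.ofReal_le_one.2 M.γ_le_one

variable {M}

theorem BoundedRewards.exists_returnsBoundedBy_of_terminatesBy [Countable A]
    (hM : M.BoundedRewards) {N : ℕ} (hN : M.TerminatesBy N) :
    ∃ B < ∞, M.ReturnsBoundedBy B := by
  refine ⟨∑ _t ∈ Finset.range N, ⨆ p : S × A, ∫⁻ y, l1dist y.1 0 ∂(M.dyn p), ?_, fun π x => ?_⟩
  · exact ENNReal.sum_lt_top.2 fun _ _ => hM
  · rw [tsum_eq_sum (s := Finset.range N)]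
    · refine Finset.sum_le_sum fun t _ => ?_
      exact (mul_le_of_le_one_left' (pow_le_one₀ zero_le M.enorm_discount_le_one)).trans
        (M.expReward_le π t x)
    · intro t ht
      rw [hN.expReward_eq_zero π (by simpa using ht), mul_zero]

theorem BoundedRewards.exists_returnsBoundedBy_of_lt_one [Countable A]
    (hM : M.BoundedRewards) (hγ : M.γ < 1) : ∃ B < ∞, M.ReturnsBoundedBy B := by
  refine ⟨(1 - ‖M.γ‖ₑ)⁻¹ * ⨆ p : S × A, ∫⁻ y, l1dist y.1 0 ∂(M.dyn p), ?_, fun π x => ?_⟩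
  · refine ENNReal.mul_lt_top ?_ hM
    rw [ENNReal.inv_lt_top, tsub_pos_iff_lt, Real.enorm_of_nonneg M.γ_pos.le]
    exact ENNReal.ofReal_lt_one.2 hγ
  · rw [← ENNReal.tsum_geometric, ← ENNReal.tsum_mul_right]
    exact ENNReal.tsum_le_tsum fun t => by gcongr; exact M.expReward_le π t x

theorem l1dist_sum_zero_le (s : Finset ℕ) (a : ℕ → Stock m) :
    l1dist (∑ t ∈ s, a t) 0 ≤ ∑ t ∈ s, l1dist (a t) 0 := by
  classical
  induction s using Finset.induction_on with
  | empty => simp [l1dist_self]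
  | insert i s hi ih =>
    rw [Finset.sum_insert hi, Finset.sum_insert hi]
    exact (l1dist_add_zero_le _ _).trans (by gcongr)

theorem l1dist_tsum_zero_le (a : ℕ → Stock m) (ha : Summable a) :
    l1dist (∑' t, a t) 0 ≤ ∑' t, l1dist (a t) 0 := by
  have hc : Continuous fun y : Stock m => l1dist y 0 := by
    unfold l1dist
    fun_prop
  refine le_of_tendsto' ((hc.tendsto _).comp ha.hasSum.tendsto_sum_nat) fun t => ?_
  exact (l1dist_sum_zero_le _ _).trans (ENNReal.sum_le_tsum _)

variable (M) in
theorem lintegral_tsum_rewards (π : HistoryPolicy S A m) (x : Aug S m) :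
    ∫⁻ ω, ∑' t, l1dist (M.γ ^ t • rewardAt t ω) 0 ∂(M.traj π x) =
      ∑' t, ‖M.γ‖ₑ ^ t * M.expReward π t x := by
  rw [lintegral_tsum fun t => by fun_prop]
  refine tsum_congr fun t => ?_
  rw [expReward, ← lintegral_const_mul _ (by fun_prop)]
  simp_rw [l1dist_smul_zero, enorm_pow]

theorem ReturnsBoundedBy.ae_summable {B : ℝ≥0∞} (h : M.ReturnsBoundedBy B) (hB : B < ∞)
    (π : HistoryPolicy S A m) (x : Aug S m) :
    ∀ᵐ ω ∂(M.traj π x), Summable fun t => M.γ ^ t • rewardAt t ω := by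
  have h1 := (M.lintegral_tsum_rewards π x).trans_le (h π x)
  filter_upwards [ae_lt_top (Measurable.tsum fun t => by fun_prop) (h1.trans_lt hB).ne] with ω hω
  exact Summable.of_enorm
    ((ENNReal.tsum_le_tsum fun t => enorm_le_l1dist _).trans_lt hω).ne

variable (M) in
theorem ret_eq (ω : Traj S A m) : M.ret ω = ∑' t, M.γ ^ t • rewardAt t ω := rfl

theorem ReturnsBoundedBy.moment_retDist_le {B : ℝ≥0∞} (h : M.ReturnsBoundedBy B) (hB : B < ∞)
    (π : HistoryPolicy S A m) (x : Aug S m) : moment (M.retDist π x) ≤ B := by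
  rw [moment, retDist, Kernel.lintegral_map _ M.measurable_ret _ (by fun_prop)]
  refine le_trans (lintegral_mono_ae ?_) ((M.lintegral_tsum_rewards π x).trans_le (h π x))
  filter_upwards [h.ae_summable hB π x] with ω hω
  exact l1dist_tsum_zero_le _ hω

theorem ReturnsBoundedBy.lintegral_stock_lt_top {B : ℝ≥0∞} (h : M.ReturnsBoundedBy B)
    (hB : B < ∞) (π : HistoryPolicy S A m) (t : ℕ) (x : Aug S m) :
    ∫⁻ y, l1dist y.2 0 ∂(M.stateLaw π t x) < ∞ := by
  have hγ : ‖M.γ ^ t‖ₑ ≠ 0 := enorm_ne_zero.2 (pow_pos M.γ_pos t).ne'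
  have h1 : ‖M.γ ^ t‖ₑ * ∫⁻ y, l1dist y.2 0 ∂(M.stateLaw π t x) ≤ l1dist x.2 0 + B := by
    rw [← lintegral_const_mul _ (by fun_prop), stateLaw, lintegral_map (by fun_prop) (by fun_prop)]
    calc _ ≤ ∫⁻ ω, (l1dist x.2 0 + ∑' t, l1dist (M.γ ^ t • rewardAt t ω) 0) ∂(M.traj π x) := by
          refine lintegral_mono_ae ?_
          filter_upwards [M.ae_smul_stock_eq π x] with ω hω
          rw [← l1dist_smul_zero, hω t]
          refine (l1dist_add_zero_le _ _).trans (add_le_add_right ?_ _)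
          exact (l1dist_sum_zero_le _ _).trans (ENNReal.sum_le_tsum _)
      _ ≤ l1dist x.2 0 + B := by
          rw [lintegral_add_left measurable_const, M.lintegral_tsum_rewards]
          simpa using add_le_add_right (h π x) _
  have h2 : l1dist x.2 0 + B < ∞ := ENNReal.add_lt_top.2 ⟨l1dist_zero_lt_top _, hB⟩
  rcases ENNReal.mul_lt_top_iff.1 (h1.trans_lt h2) with h3 | h3 | h3
  · exact h3.2
  · exact absurd h3 hγ
  · rw [h3]; exact ENNReal.zero_lt_top

/-- From a terminal state, the return vanishes. -/
theorem retDist_eq_dirac_of_isTerminal [Countable A] (π : HistoryPolicy S A m) {x : Aug S m}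
    (hx : M.IsTerminal x.1) : M.retDist π x = Measure.dirac 0 := by
  have h : ∀ᵐ ω ∂(M.traj π x), M.ret ω = 0 := by
    filter_upwards [ae_all_iff.2 fun t =>
      M.ae_rewardAt_eq_zero (M.expReward_eq_zero_of_isTerminal π t hx)] with ω hω
    simp [ret_eq, hω]
  rw [retDist, Kernel.map_apply _ M.measurable_ret, Measure.map_congr h, Measure.map_const]
  simp

/-- The kernel of laws of `c + G(s, c)`, where `G(s, c) ∼ η(s, c)`. -/
noncomputable def translate (η : Kernel (Aug S m) (Stock m)) : Kernel (Aug S m) (Stock m) :=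
  (Kernel.id ×ₖ η).map fun p => p.1.2 + p.2

theorem translate_apply (η : Kernel (Aug S m) (Stock m)) [IsSFiniteKernel η] (x : Aug S m) :
    translate η x = (η x).map fun g => x.2 + g := by
  rw [translate, Kernel.map_apply _ (by fun_prop), Kernel.prod_apply, Kernel.id_apply,
    Measure.dirac_prod, Measure.map_map (by fun_prop) (by fun_prop)]
  rfl

instance (η : Kernel (Aug S m) (Stock m)) [IsMarkovKernel η] : IsMarkovKernel (translate η) :=
  Kernel.IsMarkovKernel.map _ (by fun_prop)

theorem objective_eq_translate (K : Measure (Stock m) → ℝ) (η : Kernel (Aug S m) (Stock m))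
    [IsSFiniteKernel η] (x : Aug S m) : objective K η x = K (translate η x) := by
  rw [objective, translate_apply]

theorem ReturnsBoundedBy.moment_translate_le {B : ℝ≥0∞} (h : M.ReturnsBoundedBy B) (hB : B < ∞)
    (π : HistoryPolicy S A m) (x : Aug S m) :
    moment (translate (M.retDist π) x) ≤ l1dist x.2 0 + B := by
  rw [translate_apply]
  exact (moment_map_add_le _ _).trans (add_le_add_right (h.moment_retDist_le hB π x) _)

theorem ReturnsBoundedBy.moment_translate_lt_top {B : ℝ≥0∞} (h : M.ReturnsBoundedBy B)
    (hB : B < ∞) (π : HistoryPolicy S A m) (x : Aug S m) :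
    moment (translate (M.retDist π) x) < ∞ :=
  (h.moment_translate_le hB π x).trans_lt (ENNReal.add_lt_top.2 ⟨l1dist_zero_lt_top _, hB⟩)

theorem ReturnsBoundedBy.lintegral_moment_translate_lt_top {B : ℝ≥0∞} (h : M.ReturnsBoundedBy B)
    (hB : B < ∞) (π π' : HistoryPolicy S A m) (t : ℕ) (x : Aug S m) :
    ∫⁻ y, moment (translate (M.retDist π) y) ∂(M.stateLaw π' t x) < ∞ := by
  calc _ ≤ ∫⁻ y, (l1dist y.2 0 + B) ∂(M.stateLaw π' t x) :=
        lintegral_mono fun y => h.moment_translate_le hB π y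
    _ < ∞ := by
        rw [lintegral_add_left (by fun_prop)]
        simpa [hB] using h.lintegral_stock_lt_top hB π' t x

theorem translate_retDist_eq_map (π : HistoryPolicy S A m) (x : Aug S m) :
    translate (M.retDist π) x = (M.traj π x).map fun ω => x.2 + M.ret ω := by
  have := M.measurable_ret
  rw [translate_apply, retDist, Kernel.map_apply _ M.measurable_ret,
    Measure.map_map (by fun_prop) M.measurable_ret]
  rfl

/-- If rewards vanish from time `N` on, then `c + G = γᴺ C_N`. -/
theorem translate_retDist_eq_of_expReward_eq_zero (π : HistoryPolicy S A m) (x : Aug S m) (N : ℕ)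
    (hN : ∀ t, N ≤ t → M.expReward π t x = 0) :
    translate (M.retDist π) x = (M.stateLaw π N x).map fun y => M.γ ^ N • y.2 := by
  have h : ∀ᵐ ω ∂(M.traj π x), ∀ t, N ≤ t → rewardAt t ω = 0 :=
    ae_all_iff.2 fun t => by
      by_cases ht : N ≤ t
      · filter_upwards [M.ae_rewardAt_eq_zero (hN t ht)] with ω hω _ using hω
      · exact .of_forall fun ω h => absurd h ht
  rw [translate_retDist_eq_map, stateLaw, Measure.map_map (by fun_prop) (by fun_prop)]
  refine Measure.map_congr ?_
  filter_upwards [h, M.ae_smul_stock_eq π x] with ω hω hs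
  rw [Function.comp_apply, hs, ret_eq, tsum_eq_sum fun t ht => ?_]
  rw [hω t (by simpa using ht), smul_zero]

open Filter Topology in
/-- The discounted stock `γᵗ C_t` converges in law to `c + G`. -/
theorem ReturnsBoundedBy.tendsto_integral_stock {B : ℝ≥0∞} (h : M.ReturnsBoundedBy B)
    (hB : B < ∞) (π : HistoryPolicy S A m) (x : Aug S m)
    (f : BoundedContinuousFunction (Stock m) ℝ) :
    Tendsto (fun t => ∫ y, f (M.γ ^ t • y.2) ∂(M.stateLaw π t x)) atTop
      (𝓝 (∫ g, f g ∂(translate (M.retDist π) x))) := by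
  have hr := M.measurable_ret
  have hfm : Measurable f := f.continuous.measurable
  have h1 : ∀ t, ∫ y, f (M.γ ^ t • y.2) ∂(M.stateLaw π t x) =
      ∫ ω, f (M.γ ^ t • (stateAt t ω).2) ∂(M.traj π x) := fun t => by
    rw [stateLaw, integral_map (by fun_prop) (by fun_prop)]
  rw [translate_retDist_eq_map, integral_map (by fun_prop) (by fun_prop)]
  simp_rw [h1]
  refine tendsto_integral_of_dominated_convergence (fun _ => ‖f‖)
    (fun t => Measurable.aestronglyMeasurable (by fun_prop))
    (integrable_const _) (fun t => .of_forall fun ω => f.norm_coe_le_norm _) ?_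
  filter_upwards [h.ae_summable hB π x, M.ae_smul_stock_eq π x] with ω hω hs
  simp_rw [hs]
  exact (f.continuous.tendsto _).comp (hω.hasSum.tendsto_sum_nat.const_add _)

/-- The law of `c + G` only depends on the laws of the augmented states. -/
theorem ReturnsBoundedBy.translate_eq_of_stateLaw_eq {B : ℝ≥0∞} (h : M.ReturnsBoundedBy B)
    (hB : B < ∞) {π π' : HistoryPolicy S A m} {x : Aug S m}
    (heq : ∀ t, M.stateLaw π t x = M.stateLaw π' t x) :
    translate (M.retDist π) x = translate (M.retDist π') x := by
  refine ext_of_forall_integral_eq_of_IsFiniteMeasure fun f => ?_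
  refine tendsto_nhds_unique (h.tendsto_integral_stock hB π x f) ?_
  simp_rw [heq]
  exact h.tendsto_integral_stock hB π' x f

/-- Dynamic programming: after `n` steps, the translated return is the discounted translated
return from the augmented state reached. -/
theorem ReturnsBoundedBy.translate_retDist_eq_bind {B : ℝ≥0∞} (h : M.ReturnsBoundedBy B)
    (hB : B < ∞) (σ : MarkovPolicy S A m) (n : ℕ) (x : Aug S m) :
    translate (M.retDist σ.toHistory) x =
      (((M.marg σ n x).bind (translate (M.retDist
        (MarkovPolicy.toHistory fun k => σ (n + k))))).map fun g => M.γ ^ n • g) := by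
  have hp : IsProbabilityMeasure ((M.marg σ n x).bind (translate (M.retDist
        (MarkovPolicy.toHistory fun k => σ (n + k))))) := inferInstance
  refine ext_of_forall_integral_eq_of_IsFiniteMeasure fun f => ?_
  let f' : BoundedContinuousFunction (Stock m) ℝ :=
    f.compContinuous ⟨fun g => M.γ ^ n • g, by fun_prop⟩
  have hf' : ∀ g, f' g = f (M.γ ^ n • g) := fun g => rfl
  have hfm : Measurable f := f.continuous.measurable
  have hfm' : Measurable f' := f'.continuous.measurable
  have h1 := (h.tendsto_integral_stock hB σ.toHistory x f).comp (Filter.tendsto_add_atTop_nat n)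
  -- Both sides are limits of `𝔼 f (γ^(n+t) C_{n+t})`; condition on the augmented state at time `n`.
  refine tendsto_nhds_unique h1 ?_
  have h2 : ∀ t, ∫ y, f (M.γ ^ (t + n) • y.2) ∂(M.stateLaw σ.toHistory (t + n) x) =
      ∫ y, ∫ z, f' (M.γ ^ t • z.2) ∂(M.stateLaw (MarkovPolicy.toHistory fun k => σ (n + k)) t y)
        ∂(M.marg σ n x) := fun t => by
    simp_rw [stateLaw_toHistory, add_comm t n, marg_add]
    rw [Kernel.integral_comp]
    · simp_rw [hf', smul_smul, pow_add]
    · exact Integrable.of_bound (by fun_prop) ‖f‖ (.of_forall fun _ => f.norm_coe_le_norm _)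
  have h3 : ∫ g, f g ∂(((M.marg σ n x).bind (translate (M.retDist
        (MarkovPolicy.toHistory fun k => σ (n + k))))).map fun g => M.γ ^ n • g) =
      ∫ y, ∫ g, f' g ∂(translate (M.retDist (MarkovPolicy.toHistory fun k => σ (n + k))) y)
        ∂(M.marg σ n x) := by
    rw [integral_map (by fun_prop) (by fun_prop)]
    have hi : Integrable f' ((M.marg σ n x).bind (translate (M.retDist
        (MarkovPolicy.toHistory fun k => σ (n + k))))) :=
      Integrable.of_bound (by fun_prop) ‖f'‖ (.of_forall fun _ => f'.norm_coe_le_norm _)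
    rw [Measure.comp_eq_comp_const_apply] at hi ⊢
    exact (Kernel.integral_comp hi).trans (by rw [Kernel.const_apply])
  simp only [Function.comp_def, h2, h3]
  refine tendsto_integral_of_dominated_convergence (fun _ => ‖f'‖) (fun t => ?_)
    (integrable_const _) (fun t => .of_forall fun y => ?_) (.of_forall fun y => ?_)
  · simp_rw [stateLaw_toHistory]
    refine StronglyMeasurable.aestronglyMeasurable ?_
    exact StronglyMeasurable.integral_kernel (κ := M.marg _ t)
      (f := fun z : Aug S m => f' (M.γ ^ t • z.2)) (Measurable.stronglyMeasurable (by fun_prop))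
  · exact (norm_integral_le_of_norm_le_const
      (.of_forall fun z => f'.norm_coe_le_norm _)).trans (by simp)
  · exact h.tendsto_integral_stock hB _ y f'

end Rewards

end MDP

/-! ### Bellman operator and policy improvement -/

section Policies

variable {S A : Type u} [MeasurableSpace S] [MeasurableSpace A] {m : ℕ}

namespace MarkovPolicy

/-- Follow `σ` for `n` steps and then switch to `τ`, restarted from its beginning. -/
def splice (n : ℕ) (σ τ : MarkovPolicy S A m) : MarkovPolicy S A m :=
  fun k => if k < n then σ k else τ (k - n)

/-- Follow `π` for one step and then switch to `τ`. -/
def cons (π : StationaryPolicy S A m) (τ : MarkovPolicy S A m) : MarkovPolicy S A m :=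
  splice 1 (fun _ => π) τ

theorem splice_zero (σ τ : MarkovPolicy S A m) : splice 0 σ τ = τ := by
  funext k
  simp [splice]

theorem splice_succ (n : ℕ) (σ τ : MarkovPolicy S A m) :
    splice (n + 1) σ τ = cons (σ 0) (splice n (fun k => σ (k + 1)) τ) := by
  funext k
  cases k with
  | zero => simp [splice, cons]
  | succ k => simp [splice, cons]

theorem splice_shift (n : ℕ) (σ τ : MarkovPolicy S A m) :
    (fun k => splice n σ τ (n + k)) = τ := by
  funext k
  simp [splice]

theorem cons_const (π : StationaryPolicy S A m) :
    cons π (fun _ => π) = (fun _ => π : MarkovPolicy S A m) := by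
  funext k
  simp [splice, cons]

end MarkovPolicy

namespace MDP

variable {M : MDP S A m}

theorem marg_congr {σ τ : MarkovPolicy S A m} {n : ℕ} (h : ∀ k < n, σ k = τ k) :
    M.marg σ n = M.marg τ n := by
  induction n with
  | zero => rfl
  | succ n ih => rw [marg, marg, ih fun k hk => h k (by omega), h n (by omega)]

theorem marg_splice (n : ℕ) (σ τ : MarkovPolicy S A m) :
    M.marg (σ.splice n τ) n = M.marg σ n :=
  marg_congr fun k hk => by simp [MarkovPolicy.splice, hk]

theorem marg_cons_one (π : StationaryPolicy S A m) (τ : MarkovPolicy S A m) :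
    M.marg (MarkovPolicy.cons π τ) 1 = M.stateStep π := by
  rw [MarkovPolicy.cons, marg_splice, marg, marg, Kernel.comp_id]

variable (M) in
/-- The value `(F_K η^σ)(s, c)` of a Markov policy. -/
noncomputable def value (K : Measure (Stock m) → ℝ) (σ : MarkovPolicy S A m) (x : Aug S m) : ℝ :=
  objective K (M.retDist σ.toHistory) x

theorem value_eq (K : Measure (Stock m) → ℝ) (σ : MarkovPolicy S A m) (x : Aug S m) :
    M.value K σ x = K (translate (M.retDist σ.toHistory) x) :=
  objective_eq_translate K _ x

theorem lintegral_stateStep (π : StationaryPolicy S A m) (x : Aug S m) {f : Aug S m → ℝ≥0∞}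
    (hf : Measurable f) :
    ∫⁻ y, f y ∂(M.stateStep π x) = ∫⁻ a, ∫⁻ y, f y.2 ∂(M.augDyn (x, a)) ∂(π.act x) := by
  rw [stateStep, Kernel.lintegral_comp _ _ _ hf, Kernel.prod_apply, Kernel.id_apply,
    Measure.dirac_prod, lintegral_map (Measurable.lintegral_kernel hf) (by fun_prop)]
  simp_rw [Kernel.lintegral_map _ measurable_snd _ hf]

/-- Away from terminal states, translating `T_π η` amounts to drawing the next augmented state,
translating `η` there, and discounting: `c + (R + γ G) = γ (C' + G)` for `C' = γ⁻¹ (c + R)`. -/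
theorem map_bellman_of_not_isTerminal (π : StationaryPolicy S A m)
    (η : Kernel (Aug S m) (Stock m)) [IsMarkovKernel η] {x : Aug S m} (hx : ¬ M.IsTerminal x.1) :
    (M.bellman π η x).map (fun g => x.2 + g) =
      ((M.stateStep π x).bind (translate η)).map fun g => M.γ • g := by
  refine Measure.ext_of_lintegral _ fun f hf => ?_
  have hη : ∀ {F : (Stock m × Aug S m) × Stock m → ℝ≥0∞}, Measurable F →
      Measurable fun y : Stock m × Aug S m => ∫⁻ g, F (y, g) ∂(η y.2) := fun hF =>
    Measurable.lintegral_kernel_prod_right' (κ := Kernel.prodMkLeft (Stock m) η) hF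
  have hη' : ∀ {F : Aug S m × Stock m → ℝ≥0∞}, Measurable F →
      Measurable fun y : Aug S m => ∫⁻ g, F (y, g) ∂(η y) := fun hF =>
    Measurable.lintegral_kernel_prod_right' (κ := η) hF
  have haug : Measurable fun a => M.augDyn (x, a) := M.augDyn.measurable.comp measurable_prodMk_left
  have h1 : Measurable fun p : Aug S m × Stock m => f (M.γ • (p.1.2 + p.2)) := by fun_prop
  have h2 : Measurable fun p : (Stock m × Aug S m) × Stock m =>
      f (x.2 + (p.1.1 + M.γ • p.2)) := by fun_prop
  have hfin : ∀ a, IsProbabilityMeasure (M.augDyn (x, a)) := inferInstance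
  have hp : IsProbabilityMeasure ((π.act x).bind fun a => M.augDyn (x, a)) :=
    isProbabilityMeasure_bind haug.aemeasurable (.of_forall hfin)
  have hr : ∫⁻ g, f g ∂(((M.stateStep π x).bind (translate η)).map fun g => M.γ • g) =
      ∫⁻ y, ∫⁻ g, f (M.γ • (y.2 + g)) ∂(η y) ∂(M.stateStep π x) := by
    rw [lintegral_map hf (by fun_prop),
      Measure.lintegral_bind (Kernel.aemeasurable _) (Measurable.aemeasurable (by fun_prop))]
    refine lintegral_congr fun y => ?_
    rw [translate_apply, lintegral_map (by fun_prop) (by fun_prop)]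
  have hl1 : Measurable fun y : Stock m × Aug S m =>
      ∫⁻ g, f (x.2 + (y.1 + M.γ • g)) ∂(η y.2) := hη h2
  have hr1 : Measurable fun y : Aug S m => ∫⁻ g, f (M.γ • (y.2 + g)) ∂(η y) := hη' h1
  have hl : ∫⁻ g, f g ∂((M.bellman π η x).map fun g => x.2 + g) =
      ∫⁻ a, ∫⁻ y, ∫⁻ g, f (x.2 + (y.1 + M.γ • g)) ∂(η y.2) ∂(M.augDyn (x, a)) ∂(π.act x) := by
    rw [bellman, if_neg hx, Measure.map_map (by fun_prop) (by fun_prop),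
      lintegral_map hf (by fun_prop), Measure.lintegral_compProd (by fun_prop)]
    exact Measure.lintegral_bind haug.aemeasurable hl1.aemeasurable
  rw [hr, hl, lintegral_stateStep π x hr1]
  refine lintegral_congr fun a => ?_
  rw [M.lintegral_augDyn (x, a) hl1,
    M.lintegral_augDyn (x, a) (F := fun y => ∫⁻ g, f (M.γ • (y.2.2 + g)) ∂(η y.2))
      (hr1.comp measurable_snd)]
  refine lintegral_congr fun z => lintegral_congr fun g => ?_
  dsimp only
  rw [smul_add M.γ, smul_smul, mul_inv_cancel₀ M.γ_pos.ne', one_smul, add_assoc]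

theorem ReturnsBoundedBy.translate_cons {B : ℝ≥0∞} (h : M.ReturnsBoundedBy B) (hB : B < ∞)
    (π : StationaryPolicy S A m) (σ : MarkovPolicy S A m) (x : Aug S m) :
    translate (M.retDist (MarkovPolicy.cons π σ).toHistory) x =
      ((M.stateStep π x).bind (translate (M.retDist σ.toHistory))).map fun g => M.γ • g := by
  rw [h.translate_retDist_eq_bind hB _ 1, marg_cons_one, MarkovPolicy.cons,
    MarkovPolicy.splice_shift, pow_one]

/-- `T_π η^σ` and the return distribution of `π` followed by `σ` have the same objective. -/
theorem ReturnsBoundedBy.objective_bellman [Countable A] {B : ℝ≥0∞} (h : M.ReturnsBoundedBy B)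
    (hB : B < ∞) (K : Measure (Stock m) → ℝ) (π : StationaryPolicy S A m)
    (σ : MarkovPolicy S A m) (x : Aug S m) :
    objective K (M.bellman π (M.retDist σ.toHistory)) x = M.value K (MarkovPolicy.cons π σ) x := by
  by_cases hx : M.IsTerminal x.1
  · rw [value, objective, objective, bellman, if_pos hx, retDist_eq_dirac_of_isTerminal _ hx]
  · rw [value_eq, h.translate_cons hB, objective, map_bellman_of_not_isTerminal π _ hx]

/-- Monotonicity of the Bellman operator with respect to the objective. -/
theorem ReturnsBoundedBy.value_cons_mono {B : ℝ≥0∞} (h : M.ReturnsBoundedBy B) (hB : B < ∞)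
    {K : Measure (Stock m) → ℝ} (hmix : IndifferentToMixtures S K)
    (hγ : IndifferentToDiscount K M.γ) (π : StationaryPolicy S A m) {σ τ : MarkovPolicy S A m}
    (hστ : ∀ x, M.value K σ x ≤ M.value K τ x) (x : Aug S m) :
    M.value K (MarkovPolicy.cons π σ) x ≤ M.value K (MarkovPolicy.cons π τ) x := by
  have hstep : M.stateStep π x = M.stateLaw (MarkovPolicy.cons π σ).toHistory 1 x := by
    rw [stateLaw_toHistory, marg_cons_one]
  have hint : ∀ ξ : MarkovPolicy S A m,
      ∫⁻ y, moment (translate (M.retDist ξ.toHistory) y) ∂(M.stateStep π x) < ∞ := fun ξ => by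
    rw [hstep]
    exact h.lintegral_moment_translate_lt_top hB _ _ 1 x
  have hp : IsProbabilityMeasure (M.stateStep π x) := by rw [hstep]; infer_instance
  rw [value_eq, value_eq, h.translate_cons hB, h.translate_cons hB]
  refine hγ _ _ ?_ ?_ ?_
  · exact .of_moment_lt ((moment_bind _ _).trans_lt (hint τ))
  · exact .of_moment_lt ((moment_bind _ _).trans_lt (hint σ))
  · refine hmix.bind_le _ _ (h.moment_translate_lt_top hB _) (h.moment_translate_lt_top hB _) _
      (hint τ) (hint σ) fun y => ?_
    simpa only [value_eq] using hστ y

theorem ReturnsBoundedBy.value_cons_le_of_isGreedy [Countable A] {B : ℝ≥0∞}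
    (h : M.ReturnsBoundedBy B) (hB : B < ∞) {K : Measure (Stock m) → ℝ}
    {p p' : StationaryPolicy S A m} (hp : M.IsGreedy K (M.retDist p.toHistory) p')
    (q : StationaryPolicy S A m) (x : Aug S m) :
    M.value K (MarkovPolicy.cons q fun _ => p) x ≤
      M.value K (MarkovPolicy.cons p' fun _ => p) x := by
  rw [← h.objective_bellman hB, ← h.objective_bellman hB, ← EReal.coe_le_coe_iff]
  refine le_trans ?_ (hp x).ge
  exact le_iSup (fun π => (objective K (M.bellman π (M.retDist p.toHistory)) x : EReal)) q

theorem ReturnsBoundedBy.value_const_le_cons [Countable A] {B : ℝ≥0∞}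
    (h : M.ReturnsBoundedBy B) (hB : B < ∞) {K : Measure (Stock m) → ℝ}
    {p p' : StationaryPolicy S A m} (hp : M.IsGreedy K (M.retDist p.toHistory) p') (x : Aug S m) :
    M.value K (fun _ => p) x ≤ M.value K (MarkovPolicy.cons p' fun _ => p) x := by
  have := h.value_cons_le_of_isGreedy hB hp p x
  rwa [MarkovPolicy.cons_const] at this

/-- Following the greedy policy for longer before switching back does not decrease the value. -/
theorem ReturnsBoundedBy.value_cons_le_splice [Countable A] {B : ℝ≥0∞}
    (h : M.ReturnsBoundedBy B) (hB : B < ∞) {K : Measure (Stock m) → ℝ}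
    (hmix : IndifferentToMixtures S K) (hγ : IndifferentToDiscount K M.γ)
    {p p' : StationaryPolicy S A m} (hp : M.IsGreedy K (M.retDist p.toHistory) p') (k : ℕ)
    (x : Aug S m) :
    M.value K (MarkovPolicy.cons p' fun _ => p) x ≤
      M.value K (MarkovPolicy.splice (k + 1) (fun _ => p') fun _ => p) x := by
  have hstep : ∀ k x, M.value K (MarkovPolicy.splice k (fun _ => p') fun _ => p) x ≤
      M.value K (MarkovPolicy.splice (k + 1) (fun _ => p') fun _ => p) x := by
    intro k
    induction k with
    | zero =>
      intro x
      rw [MarkovPolicy.splice_zero]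
      exact h.value_const_le_cons hB hp x
    | succ k ih =>
      intro x
      rw [MarkovPolicy.splice_succ, MarkovPolicy.splice_succ (k + 1)]
      exact h.value_cons_mono hB hmix hγ _ ih x
  induction k with
  | zero => exact le_rfl
  | succ k ih => exact ih.trans (hstep (k + 1) x)

/-- If policy improvement holds at every iteration, then after `n` iterations the policy does at
least as well as any Markov policy that is followed for `n` steps before switching to `π₀`. -/
theorem ReturnsBoundedBy.value_splice_le [Countable A] {B : ℝ≥0∞}
    (h : M.ReturnsBoundedBy B) (hB : B < ∞) {K : Measure (Stock m) → ℝ}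
    (hmix : IndifferentToMixtures S K) (hγ : IndifferentToDiscount K M.γ)
    {π : ℕ → StationaryPolicy S A m}
    (hπ : ∀ n, M.IsGreedy K (M.retDist (π n).toHistory) (π (n + 1)))
    (himp : ∀ n x, M.value K (MarkovPolicy.cons (π (n + 1)) fun _ => π n) x ≤
      M.value K (fun _ => π (n + 1)) x) (n : ℕ) (σ : MarkovPolicy S A m) (x : Aug S m) :
    M.value K (σ.splice n fun _ => π 0) x ≤ M.value K (fun _ => π n) x := by
  induction n generalizing σ x with
  | zero => rw [MarkovPolicy.splice_zero]
  | succ n ih =>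
    rw [MarkovPolicy.splice_succ]
    calc _ ≤ M.value K (MarkovPolicy.cons (σ 0) fun _ => π n) x :=
          h.value_cons_mono hB hmix hγ _ (ih _) x
      _ ≤ M.value K (MarkovPolicy.cons (π (n + 1)) fun _ => π n) x :=
          h.value_cons_le_of_isGreedy hB (hπ n) _ x
      _ ≤ _ := himp n x

theorem ReturnsBoundedBy.exists_markov_value_eq [Finite A] [MeasurableSingletonClass A]
    {B : ℝ≥0∞} (h : M.ReturnsBoundedBy B) (hB : B < ∞) (K : Measure (Stock m) → ℝ)
    (π : HistoryPolicy S A m) (x : Aug S m) :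
    ∃ σ : MarkovPolicy S A m, objective K (M.retDist π) x = M.value K σ x := by
  obtain ⟨σ, hσ⟩ := M.exists_markov_stateLaw_eq π x
  refine ⟨σ, ?_⟩
  rw [objective_eq_translate, value_eq, h.translate_eq_of_stateLaw_eq hB fun t => (hσ t).symm]

/-- After the horizon, the policy is irrelevant. -/
theorem TerminatesBy.value_splice [Countable A] {N : ℕ} (hN : M.TerminatesBy N)
    (K : Measure (Stock m) → ℝ) (σ τ : MarkovPolicy S A m) {n : ℕ} (hn : N ≤ n) (x : Aug S m) :
    M.value K (σ.splice n τ) x = M.value K σ x := by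
  have h : ∀ σ : MarkovPolicy S A m, translate (M.retDist σ.toHistory) x =
      (M.marg σ n x).map fun y => M.γ ^ n • y.2 := fun σ => by
    rw [← stateLaw_toHistory, translate_retDist_eq_of_expReward_eq_zero _ _ n
      fun t ht => hN.expReward_eq_zero _ (hn.trans ht) x]
  rw [value_eq, value_eq, h, h, marg_splice]

/-- With a Lipschitz functional, the policy followed after `n` steps matters by at most
`L γⁿ` times the distance between return distributions. -/
theorem ReturnsBoundedBy.abs_value_splice_sub_le {B : ℝ≥0∞} (h : M.ReturnsBoundedBy B)
    (hB : B < ∞) {K : Measure (Stock m) → ℝ} {L : ℝ} (hL : 0 ≤ L) (hK : LipschitzOnD K L)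
    (σ τ : MarkovPolicy S A m) (n : ℕ) {W : ℝ} (hW0 : 0 ≤ W)
    (hW : supWass (M.retDist τ.toHistory)
      (M.retDist (MarkovPolicy.toHistory fun k => σ (n + k))) ≤ ENNReal.ofReal W) (x : Aug S m) :
    |M.value K (σ.splice n τ) x - M.value K σ x| ≤ L * (M.γ ^ n * W) := by
  have hγ : (0 : ℝ) < M.γ ^ n := pow_pos M.γ_pos n
  let ζ (ξ : MarkovPolicy S A m) : Kernel (Aug S m) (Stock m) :=
    (translate (M.retDist ξ.toHistory)).map fun g => M.γ ^ n • g
  have hζM : ∀ ξ, IsMarkovKernel (ζ ξ) := fun ξ => Kernel.IsMarkovKernel.map _ (by fun_prop)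
  have hζa : ∀ ξ y, ζ ξ y = (translate (M.retDist ξ.toHistory) y).map fun g => M.γ ^ n • g :=
    fun ξ y => Kernel.map_apply _ (by fun_prop) _
  have hζa' : ∀ ξ y, ζ ξ y = (M.retDist ξ.toHistory y).map fun g => M.γ ^ n • (y.2 + g) :=
    fun ξ y => by
    rw [hζa, translate_apply, Measure.map_map (by fun_prop) (by fun_prop)]
    rfl
  have hζm : ∀ ξ y, moment (ζ ξ y) < ∞ := fun ξ y => by
    rw [hζa, moment_map_smul]
    exact ENNReal.mul_lt_top enorm_lt_top (h.moment_translate_lt_top hB _ y)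
  have hζi : ∀ ξ, ∫⁻ y, moment (ζ ξ y) ∂(M.marg σ n x) < ∞ := fun ξ => by
    simp_rw [hζa, moment_map_smul]
    rw [lintegral_const_mul _ (measurable_moment _), ← stateLaw_toHistory]
    exact ENNReal.mul_lt_top enorm_lt_top (h.lintegral_moment_translate_lt_top hB _ _ n x)
  have hv : ∀ ξ : MarkovPolicy S A m, M.value K ξ x =
      K ((M.marg ξ n x).bind (ζ fun k => ξ (n + k))) := fun ξ => by
    rw [value_eq, h.translate_retDist_eq_bind hB ξ n x, Measure.map_comp _ _ (by fun_prop)]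
  rw [hv, hv, marg_splice, MarkovPolicy.splice_shift]
  refine hK.sub_bind_le hL _ _ _ (hζm _) (hζm _) (hζi _) (hζi _) (by positivity) fun y => ?_
  rw [hζa', hζa', ENNReal.ofReal_mul hγ.le, ← Real.enorm_of_nonneg hγ.le]
  refine (wass_map_affine_le hγ.ne' _ _ _).trans ?_
  gcongr
  exact (le_iSup (fun y => wass (M.retDist τ.toHistory y)
    (M.retDist (MarkovPolicy.toHistory fun k => σ (n + k)) y)) y).trans hW

theorem ReturnsBoundedBy.supWass_le {B : ℝ≥0∞} (h : M.ReturnsBoundedBy B) (hB : B < ∞)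
    (π π' : HistoryPolicy S A m) : supWass (M.retDist π) (M.retDist π') ≤ B + B :=
  iSup_le fun x => (wass_le_moment_add_moment _ _).trans
    (add_le_add (h.moment_retDist_le hB π x) (h.moment_retDist_le hB π' x))

/-- Policy improvement in the discounted case, by letting the switch back to `p` happen later and
later. -/
theorem ReturnsBoundedBy.value_cons_le_of_lipschitz [Countable A] {B : ℝ≥0∞}
    (h : M.ReturnsBoundedBy B) (hB : B < ∞) {K : Measure (Stock m) → ℝ}
    (hmix : IndifferentToMixtures S K) (hγ : IndifferentToDiscount K M.γ) (hγ1 : M.γ < 1)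
    {L : ℝ} (hL : 0 ≤ L) (hK : LipschitzOnD K L) {p p' : StationaryPolicy S A m}
    (hp : M.IsGreedy K (M.retDist p.toHistory) p') (x : Aug S m) :
    M.value K (MarkovPolicy.cons p' fun _ => p) x ≤ M.value K (fun _ => p') x := by
  have hBB : B + B ≠ ∞ := (ENNReal.add_lt_top.2 ⟨hB, hB⟩).ne
  have hbound : ∀ k : ℕ, M.value K (MarkovPolicy.cons p' fun _ => p) x ≤
      M.value K (fun _ => p') x + L * (M.γ ^ (k + 1) * (B + B).toReal) := fun k => by
    have h1 := h.value_cons_le_splice hB hmix hγ hp k x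
    have h2 := h.abs_value_splice_sub_le hB hL hK (fun _ => p') (fun _ => p) (k + 1)
      (W := (B + B).toReal) ENNReal.toReal_nonneg
      (by rw [ENNReal.ofReal_toReal hBB]; exact h.supWass_le hB _ _) x
    linarith [le_of_abs_le h2]
  have hlim : Filter.Tendsto
      (fun k : ℕ => M.value K (fun _ => p') x + L * (M.γ ^ (k + 1) * (B + B).toReal))
      Filter.atTop (nhds (M.value K (fun _ => p') x + L * (0 * (B + B).toReal))) :=
    ((((tendsto_pow_atTop_nhds_zero_of_lt_one M.γ_pos.le hγ1).comp
      (Filter.tendsto_add_atTop_nat 1)).mul_const _).const_mul _).const_add _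
  rw [zero_mul, mul_zero, add_zero] at hlim
  exact ge_of_tendsto' hlim hbound

end MDP

end Policies

theorem LipschitzOnD.wass_eq_zero_of_neg {m : ℕ} {K : Measure (Stock m) → ℝ} {L : ℝ}
    (hK : LipschitzOnD K L) (hL : L < 0) {ν ν' : Measure (Stock m)} (hν : InD ν) (hν' : InD ν') :
    wass ν ν' = 0 := by
  have h := (abs_nonneg _).trans (hK ν ν' hν hν')
  have h0 : (wass ν ν').toReal = 0 :=
    le_antisymm (nonpos_of_mul_nonneg_right h hL) ENNReal.toReal_nonneg
  exact ((ENNReal.toReal_eq_zero_iff _).1 h0).resolve_right (hν.wass_lt_top hν').ne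

end StockDP

open StockDP in
theorem mainTheorem2 {S A : Type u} [MeasurableSpace S] [Finite A] [MeasurableSpace A]
    [MeasurableSingletonClass A] {m : ℕ} (M : StockDP.MDP S A m) (hM : M.BoundedRewards)
    (K : MeasureTheory.Measure (StockDP.Stock m) → ℝ)
    (hmix : StockDP.IndifferentToMixtures S K) (hγ : StockDP.IndifferentToDiscount K M.γ)
    (π : ℕ → StockDP.StationaryPolicy S A m)
    (hπ : ∀ n, M.IsGreedy K (M.retDist (π n).toHistory) (π (n + 1))) :
    (∀ N, M.HasHorizon N → ∀ n, N ≤ n → ∀ x : StockDP.Aug S m,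
      (StockDP.objective K (M.retDist (π n).toHistory) x : EReal) =
        ⨆ σ : StockDP.HistoryPolicy S A m,
          (StockDP.objective K (M.retDist σ) x : EReal)) ∧
    (M.γ < 1 → ∀ L : ℝ, StockDP.LipschitzOnD K L → ∀ (n : ℕ) (x : StockDP.Aug S m),
      (⨆ σ : StockDP.HistoryPolicy S A m, (StockDP.objective K (M.retDist σ) x : EReal)) -
          (StockDP.objective K (M.retDist (π n).toHistory) x : EReal) ≤
        ((L * M.γ ^ n : ℝ) : EReal) *
          ((⨆ σ : StockDP.MarkovPolicy S A m,
            StockDP.supWass (M.retDist (π 0).toHistory) (M.retDist σ.toHistory) : ENNReal) :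
            EReal)) := by
  refine ⟨fun N hN n hn x => ?_, fun hγ1 L hK n x => ?_⟩
  · have hNT : M.TerminatesBy N := hN.1.2
    obtain ⟨B, hB, h⟩ := hM.exists_returnsBoundedBy_of_terminatesBy hNT
    have himp : ∀ n x, M.value K (MarkovPolicy.cons (π (n + 1)) fun _ => π n) x ≤
        M.value K (fun _ => π (n + 1)) x := fun n x => by
      refine (h.value_cons_le_splice hB hmix hγ (hπ n) N x).trans_eq ?_
      exact hNT.value_splice K _ _ (Nat.le_succ N) x
    refine le_antisymm (le_iSup (fun σ : HistoryPolicy S A m =>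
      (objective K (M.retDist σ) x : EReal)) (π n).toHistory) (iSup_le fun σ => ?_)
    obtain ⟨σ', hσ'⟩ := h.exists_markov_value_eq hB K σ x
    rw [EReal.coe_le_coe_iff, hσ', ← hNT.value_splice K σ' (fun _ => π 0) hn x]
    exact h.value_splice_le hB hmix hγ hπ himp n σ' x
  · obtain ⟨B, hB, h⟩ := hM.exists_returnsBoundedBy_of_lt_one hγ1
    set W : ℝ≥0∞ := ⨆ σ : MarkovPolicy S A m,
      supWass (M.retDist (π 0).toHistory) (M.retDist σ.toHistory) with hWdef
    have hW : W ≠ ∞ := ((iSup_le fun σ => h.supWass_le hB _ _).trans_lt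
      (ENNReal.add_lt_top.2 ⟨hB, hB⟩)).ne
    have key : ∀ L' : ℝ, 0 ≤ L' → LipschitzOnD K L' → ∀ σ : HistoryPolicy S A m,
        objective K (M.retDist σ) x ≤
          L' * (M.γ ^ n * W.toReal) + objective K (M.retDist (π n).toHistory) x := by
      intro L' hL' hK' σ
      obtain ⟨σ', hσ'⟩ := h.exists_markov_value_eq hB K σ x
      have h1 := h.abs_value_splice_sub_le hB hL' hK' σ' (fun _ => π 0) n (W := W.toReal)
        ENNReal.toReal_nonneg (by
          rw [ENNReal.ofReal_toReal hW]
          exact le_iSup (fun σ : MarkovPolicy S A m =>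
            supWass (M.retDist (π 0).toHistory) (M.retDist σ.toHistory)) fun k => σ' (n + k)) x
      have h2 := h.value_splice_le hB hmix hγ hπ
        (fun n x => h.value_cons_le_of_lipschitz hB hmix hγ hγ1 hL' hK' (hπ n) x) n σ' x
      rw [hσ']
      change M.value K σ' x ≤ L' * (M.γ ^ n * W.toReal) + M.value K (fun _ => π n) x
      linarith [neg_le_of_abs_le h1]
    have hfinal : ∀ σ : HistoryPolicy S A m, objective K (M.retDist σ) x ≤
        L * M.γ ^ n * W.toReal + objective K (M.retDist (π n).toHistory) x := by
      rcases le_or_gt 0 L with hL | hL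
      · intro σ
        rw [mul_assoc]
        exact key L hL hK σ
      · -- A negative Lipschitz constant forces all distances to vanish.
        have hD : ∀ (σ : HistoryPolicy S A m) y, InD (M.retDist σ y) := fun σ y =>
          .of_moment_lt ((h.moment_retDist_le hB σ y).trans_lt hB)
        have hW0 : W = 0 := by
          simp only [hWdef, supWass, ENNReal.iSup_eq_zero]
          exact fun σ y => hK.wass_eq_zero_of_neg hL (hD _ y) (hD _ y)
        have hK0 : LipschitzOnD K 0 := fun ν ν' hν hν' => by
          have := hK ν ν' hν hν'
          rw [hK.wass_eq_zero_of_neg hL hν hν'] at this ⊢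
          simpa using this
        intro σ
        have := key 0 le_rfl hK0 σ
        rw [hW0] at this ⊢
        simpa using this
    rw [← EReal.coe_ennreal_toReal hW, ← EReal.coe_mul]
    refine EReal.sub_le_of_le_add (iSup_le fun σ => ?_)
    rw [← EReal.coe_add, EReal.coe_le_coe_iff]
    exact hfinal σ
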